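/- Consider the following model. The base stations $X_0,X_1,\dots$ form a homogeneous Poisson point process (PPP) $\Phi_{\mathrm{BS}}$ on $\mathbb{R}^2$ with intensity $\lambda_{\mathrm{BS}}>0$; a user sits at the origin. Fix $p\in[0,1]$, $D>0$, $\beta\in\mathbb{R}$, $\alpha_L,\alpha_N>0$ and $\xi_L,\xi_N>0$. A base station at $y$ is line-of-sight (LOS) with probability $p$ if $\|y\|\le D$, and never if $\|y\|>D$; otherwise it is non-line-of-sight (NLOS). The (linear) shadowing factor of an LOS station is $S_{y,L}=10^{-(\beta+Z)/10}$ with $Z\sim N(0,\xi_L^2)$, that of an NLOS station is $S_{y,N}=10^{-(\beta+Z)/10}$ with $Z\sim N(0,\xi_N^2)$; thus $S_{y,j}$ is lognormal and $\ln S_{y,j}\sim N(m,\sigma_j^2)$ with $m=-0.1\,\beta\ln 10$ and $\sigma_j=0.1\,\xi_j\ln 10$, $j\in\{L,N\}$. The blockage and shadowing variables are independent of each other, independent across stations and independent of $\Phi_{\mathrm{BS}}$. Let $\Phi_L,\Phi_N$ be the point processes of LOS and NLOS stations, and let $$\mathcal N_L=\{\|y\|^{\alpha_L}/S_{y,L}:y\in\Phi_L\},\qquad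 \mathcal N_N=\{\|y\|^{\alpha_N}/S_{y,N}:y\in\Phi_N\}$$ be the corresponding propagation-loss processes, regarded as point processes on $\mathbb{R}_+=[0,\infty)$. Write $Q$ for the standard Gaussian complementary distribution function and $\Upsilon_j(t)=\bigl(\ln(D^{\alpha_j}/t)-m\bigr)/\sigma_j$. Then $\Phi_L$ and $\Phi_N$ are PPPs with intensities $\lambda_{\mathrm{BS}}\,p\,\mathbf 1_{\{\|x\|\le D\}}$ and $\lambda_{\mathrm{BS}}(1-p)\mathbf 1_{\{\|x\|\le D\}}+\lambda_{\mathrm{BS}}\mathbf 1_{\{\|x\|>D\}}$, and: 1. $\mathcal N_L$ is a (in general non-homogeneous) PPP on $\mathbb{R}_+$ whose mean measure $\Lambda_L$ satisfies, for all $t>0$, $\Lambda_L([0,t))=\lambda_{\mathrm{BS}}M_L(t)$, where $$M_L(t)=\pi p\left[D^2Q(\Upsilon_L(t))+t^{2/\alpha_L}\exp\left(\frac{2\sigma_L^2}{\alpha_L^2}+\frac{2m}{\alpha_L}\right)Q\left(\frac{2\sigma_L^2}{\alpha_L\sigma_L}-\Upsilon_L(t)\right)\right].$$ 2. $\mathcal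 N_N$ is a (in general non-homogeneous) PPP on $\mathbb{R}_+$ whose mean measure $\Lambda_N$ satisfies, for all $t>0$, $\Lambda_N([0,t))=\lambda_{\mathrm{BS}}M_N(t)$, where $$M_N(t)=-\pi pD^2Q(\Upsilon_N(t))+\pi t^{2/\alpha_N}\exp\left(\frac{2\sigma_N^2}{\alpha_N^2}+\frac{2m}{\alpha_N}\right)\left[1-p\,Q\left(\frac{2\sigma_N^2}{\alpha_N\sigma_N}-\Upsilon_N(t)\right)\right].$$ 3. The point process $\mathcal N$ of the propagation losses of all base stations, which is the superposition of $\mathcal N_L$ and $\mathcal N_N$, is a PPP on $\mathbb{R}_+$ whose mean measure $\Lambda$ satisfies $\Lambda([0,t))=\Lambda((0,t])=\lambda_{\mathrm{BS}}\,(M_L(t)+M_N(t))$ for all $t>0$. -/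

import Mathlib

open MeasureTheory ProbabilityTheory Set
open scoped NNReal ENNReal

noncomputable section

/-- `N` is a Poisson point process on `E` with (locally finite) mean measure `Λ`: a measurable,
locally finite random counting measure such that `N(B)` is Poisson with parameter `Λ(B)` for every
measurable `B` with `Λ(B) < ∞`, and such that the counts of finitely many pairwise disjoint sets of
this kind are independent. As `Λ` is locally finite, this determines the law of `N`. -/
structure IsPoissonPointProcess {Ω E : Type*} [MeasurableSpace Ω] [TopologicalSpace E]
    [MeasurableSpace E] (P : Measure Ω) (N : Ω → Measure E) (Λ : Measure E) : Prop where
  mean_finite_of_compact : ∀ K : Set E, IsCompact K → Λ K < ∞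
  measurable_count : ∀ B : Set E, MeasurableSet B → Measurable fun ω => N ω B
  counting : ∀ᵐ ω ∂P, ∀ B : Set E, MeasurableSet B → ∃ k : ℕ∞, N ω B = (k : ℝ≥0∞)
  finite_of_compact : ∀ᵐ ω ∂P, ∀ K : Set E, IsCompact K → N ω K < ∞
  poisson : ∀ B : Set E, MeasurableSet B → Λ B < ∞ →
    HasLaw (fun ω => N ω B)
      ((poissonMeasure (Λ B).toNNReal).map (fun k : ℕ => (k : ℝ≥0∞))) P
  indep : ∀ (k : ℕ) (B : Fin k → Set E), (∀ i, MeasurableSet (B i)) → (∀ i, Λ (B i) < ∞) →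
    Pairwise (fun i j => Disjoint (B i) (B j)) → iIndepFun (fun i ω => N ω (B i)) P

open Classical in
/-- The counting measure `∑ δ_{x n}`, the sum being over those `n` for which `keep n` holds. -/
def pointMeasure {E : Type*} [MeasurableSpace E] (keep : ℕ → Prop) (x : ℕ → E) : Measure E :=
  Measure.sum fun n => if keep n then Measure.dirac (x n) else 0

/-- The plane, with the Euclidean norm. -/
abbrev Plane := EuclideanSpace ℝ (Fin 2)

/-- The link from a base station at `y` to the user at the origin is line-of-sight: it is at most
`D` long and its blockage mark `b` says that it is not blocked. -/
def IsLOS (D : ℝ) (b : Bool) (y : Plane) : Prop := b = true ∧ ‖y‖ ≤ D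

/-- The (linear scale) shadowing factor `S = 10 ^ (-(β + z) / 10)`, where `β` is the path loss at
reference distance 1 and `z` the shadowing, both in dB. If `z` is centred Gaussian with standard
deviation `ξ`, then `S` is lognormal: `log S` is Gaussian with mean `-0.1 β log 10` and standard
deviation `0.1 ξ log 10`. -/
def shadowFactor (β z : ℝ) : ℝ := (10 : ℝ) ^ (-(β + z) / 10)

/-- The propagation loss `‖y‖ ^ α / S` from a base station at `y` to the user at the origin; in dB
this is `β + 10 α log₁₀ ‖y‖ + z`. -/
def propLoss (α β z : ℝ) (y : Plane) : ℝ≥0 :=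
  ⟨‖y‖ ^ α / shadowFactor β z,
    div_nonneg (Real.rpow_nonneg (norm_nonneg y) α) (Real.rpow_nonneg (by norm_num) _)⟩

/-- The base stations `X n` form a homogeneous Poisson point process of intensity `lam` in the
plane. They carry i.i.d. marks `(T n, ZL n, ZN n)`, independent of the positions: the blockage mark
`T n` is Bernoulli with parameter `p`, and is independent of `ZL n` and of `ZN n`, the shadowing in
dB that the link sees if it is line-of-sight, respectively non-line-of-sight; these are centred
Gaussian with standard deviations `ξL` and `ξN`. -/
structure IsCellularNetwork {Ω : Type*} [MeasurableSpace Ω] (P : Measure Ω)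
    (lam p ξL ξN : ℝ) (X : ℕ → Ω → Plane) (T : ℕ → Ω → Bool) (ZL ZN : ℕ → Ω → ℝ) : Prop where
  measurable_X : ∀ n, Measurable (X n)
  measurable_T : ∀ n, Measurable (T n)
  measurable_ZL : ∀ n, Measurable (ZL n)
  measurable_ZN : ∀ n, Measurable (ZN n)
  poisson : IsPoissonPointProcess P (fun ω => pointMeasure (fun _ => True) (fun n => X n ω))
    (ENNReal.ofReal lam • (volume : Measure Plane))
  marks_indep_positions : IndepFun (fun ω n => X n ω) (fun ω n => (T n ω, ZL n ω, ZN n ω)) P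
  marks_indep : iIndepFun (fun n ω => (T n ω, ZL n ω, ZN n ω)) P
  marks_identDistrib : ∀ n, IdentDistrib (fun ω => (T n ω, ZL n ω, ZN n ω))
    (fun ω => (T 0 ω, ZL 0 ω, ZN 0 ω)) P P
  bernoulli : ∀ n, P.real {ω | T n ω = true} = p
  gaussianL : ∀ n, HasLaw (ZL n) (gaussianReal 0 (ξL ^ 2).toNNReal) P
  gaussianN : ∀ n, HasLaw (ZN n) (gaussianReal 0 (ξN ^ 2).toNNReal) P
  indepL : ∀ n, IndepFun (T n) (ZL n) P
  indepN : ∀ n, IndepFun (T n) (ZN n) P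

/-- The point process of line-of-sight base stations. -/
def losStations {Ω : Type*} (D : ℝ) (X : ℕ → Ω → Plane) (T : ℕ → Ω → Bool) (ω : Ω) :
    Measure Plane :=
  pointMeasure (fun n => IsLOS D (T n ω) (X n ω)) (fun n => X n ω)

/-- The point process of non-line-of-sight base stations. -/
def nlosStations {Ω : Type*} (D : ℝ) (X : ℕ → Ω → Plane) (T : ℕ → Ω → Bool) (ω : Ω) :
    Measure Plane :=
  pointMeasure (fun n => ¬ IsLOS D (T n ω) (X n ω)) (fun n => X n ω)

/-- The line-of-sight propagation loss process. -/
def losLosses {Ω : Type*} (D β αL : ℝ) (X : ℕ → Ω → Plane) (T : ℕ → Ω → Bool)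
    (ZL : ℕ → Ω → ℝ) (ω : Ω) : Measure ℝ≥0 :=
  pointMeasure (fun n => IsLOS D (T n ω) (X n ω)) (fun n => propLoss αL β (ZL n ω) (X n ω))

/-- The non-line-of-sight propagation loss process. -/
def nlosLosses {Ω : Type*} (D β αN : ℝ) (X : ℕ → Ω → Plane) (T : ℕ → Ω → Bool)
    (ZN : ℕ → Ω → ℝ) (ω : Ω) : Measure ℝ≥0 :=
  pointMeasure (fun n => ¬ IsLOS D (T n ω) (X n ω)) (fun n => propLoss αN β (ZN n ω) (X n ω))

open Classical in
/-- The point process of the propagation losses of all base stations. -/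
def allLosses {Ω : Type*} (D β αL αN : ℝ) (X : ℕ → Ω → Plane) (T : ℕ → Ω → Bool)
    (ZL ZN : ℕ → Ω → ℝ) (ω : Ω) : Measure ℝ≥0 :=
  pointMeasure (fun _ => True) (fun n =>
    if IsLOS D (T n ω) (X n ω) then propLoss αL β (ZL n ω) (X n ω)
    else propLoss αN β (ZN n ω) (X n ω))

/-- The Q-function: the complementary distribution function of the standard Gaussian. -/
def gaussQ (x : ℝ) : ℝ := (gaussianReal 0 1).real (Ioi x)

/-- The mean of the logarithm of the shadowing factor. -/
def logMean (β : ℝ) : ℝ := -0.1 * β * Real.log 10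

/-- The standard deviation of the logarithm of the shadowing factor. -/
def logStd (ξ : ℝ) : ℝ := 0.1 * ξ * Real.log 10

/-- `Υ(t) = (log (D ^ α / t) - m) / σ`. -/
def upsilon (D β α ξ t : ℝ) : ℝ := (Real.log (D ^ α / t) - logMean β) / logStd ξ

/-- The function `M_L`. -/
def meanLOS (p D β α ξ t : ℝ) : ℝ :=
  Real.pi * p * (D ^ 2 * gaussQ (upsilon D β α ξ t)
    + t ^ (2 / α) * Real.exp (2 * logStd ξ ^ 2 / α ^ 2 + 2 * logMean β / α)
      * gaussQ (2 * logStd ξ ^ 2 / (α * logStd ξ) - upsilon D β α ξ t))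

/-- The function `M_N`. -/
def meanNLOS (p D β α ξ t : ℝ) : ℝ :=
  -(Real.pi * p * D ^ 2 * gaussQ (upsilon D β α ξ t))
    + Real.pi * t ^ (2 / α) * Real.exp (2 * logStd ξ ^ 2 / α ^ 2 + 2 * logMean β / α)
      * (1 - p * gaussQ (2 * logStd ξ ^ 2 / (α * logStd ξ) - upsilon D β α ξ t))

end

/-! A Poisson process with σ-finite mean measure Λ has Laplace functional E exp(-∫ f dN) = exp(-∫ (1
- e^{-f}) dΛ) for measurable f ≥ 0 (`IsPoissonPointProcess.laplace`). Conversely, when Λ is locally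
finite, this formula forces a point process to be Poisson, because finite measures on [0, ∞]^ι are
determined by their Laplace transforms (`ext_of_lintegral_negExp`,
`isPoissonPointProcess_of_laplace`).

I.i.d. marks of law ν, independent of the positions, only replace e^{-f} by its average over the
mark, so the formula persists with Λ ⊗ ν in place of Λ (`laplace_marked`). Keeping the marked points
in K and mapping them by φ amounts to testing against 1_K · (f ∘ φ). All five processes arise in
this way from the marked stations (`isPoissonPointProcess_marked`).

For the mean measures, fix the shadowing factor S: the positions with loss below t form a disc of
radius (tS)^{1/α}, and those also within distance D have area π min(D², (tS)^{2/α}). Averaging over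
the Gaussian, D² contributes a Gaussian tail and (tS)^{2/α} another one after exponential tilting
(`lintegral_min_mul_shadowFactor_rpow`). The NLOS mean is the mean without blockage minus the LOS
mean. -/

/-! ### The exponential x ↦ e^{-x} on [0, ∞] and the Poisson Laplace transform. -/

/-- The function `x ↦ exp (-x)` on `[0, ∞]`, with value `0` at `∞`. -/
noncomputable def negExp (x : ℝ≥0∞) : ℝ≥0∞ := EReal.exp (-(x : EReal))

lemma negExp_zero : negExp 0 = 1 := by simp [negExp]

lemma negExp_add (x y : ℝ≥0∞) : negExp (x + y) = negExp x * negExp y := by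
  rw [negExp, negExp, negExp, ← EReal.exp_add, EReal.coe_ennreal_add, EReal.neg_add, sub_eq_add_neg]
  · exact .inl (EReal.coe_ennreal_ne_bot x)
  · exact .inr (EReal.coe_ennreal_ne_bot y)

lemma negExp_le_one (x : ℝ≥0∞) : negExp x ≤ 1 := by
  simpa [negExp] using EReal.coe_ennreal_nonneg x

lemma negExp_ne_top (x : ℝ≥0∞) : negExp x ≠ ∞ :=
  ((negExp_le_one x).trans_lt ENNReal.one_lt_top).ne

lemma negExp_coe (x : ℝ≥0) : negExp x = ENNReal.ofReal (Real.exp (-x)) := by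
  have : (-((x : ℝ≥0∞) : EReal)) = ((-(x : ℝ) : ℝ) : EReal) := by
    rw [EReal.coe_neg]; rfl
  rw [negExp, this, EReal.exp_coe]

lemma negExp_strictAnti : StrictAnti negExp := fun x y h => by
  simpa [negExp, EReal.exp_lt_exp_iff, EReal.neg_lt_neg_iff] using h

lemma continuous_negExp : Continuous negExp :=
  ENNReal.continuous_exp.comp (continuous_neg.comp continuous_coe_ennreal_ereal)

lemma measurable_negExp : Measurable negExp := continuous_negExp.measurable

lemma negExp_sum {ι : Type*} (s : Finset ι) (f : ι → ℝ≥0∞) :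
    negExp (∑ i ∈ s, f i) = ∏ i ∈ s, negExp (f i) := by
  classical
  induction s using Finset.induction_on with
  | empty => simp [negExp_zero]
  | insert a s ha ih => rw [Finset.sum_insert ha, Finset.prod_insert ha, negExp_add, ih]

lemma negExp_mul_natCast (c : ℝ≥0∞) (n : ℕ) : negExp (c * n) = negExp c ^ n := by
  have := negExp_sum (Finset.range n) (fun _ => c)
  simpa [mul_comm] using this

/-- The inverse of `negExp` on `[0, 1]`. -/
noncomputable def negLog (y : ℝ≥0∞) : ℝ≥0∞ := (-ENNReal.log y).toENNReal

lemma measurable_negLog : Measurable negLog :=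
  (continuous_neg.measurable.comp ENNReal.measurable_log).ereal_toENNReal

lemma negExp_negLog {y : ℝ≥0∞} (hy : y ≤ 1) : negExp (negLog y) = y := by
  rw [negExp, negLog, EReal.coe_toENNReal, neg_neg, ENNReal.exp_log]
  have : ENNReal.log y ≤ 0 := by simpa using hy
  simpa using EReal.neg_le_neg_iff.2 this

/-- Dominated convergence with bound 1. As `negExp` is continuous at ∞ as well, the limit `G` may be
infinite. -/
lemma tendsto_lintegral_negExp {Ω : Type*} [MeasurableSpace Ω] {P : Measure Ω}
    [IsFiniteMeasure P] {g : ℕ → Ω → ℝ≥0∞} {G : Ω → ℝ≥0∞} (hg : ∀ n, Measurable (g n))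
    (h : ∀ ω, Filter.Tendsto (fun n => g n ω) Filter.atTop (nhds (G ω))) :
    Filter.Tendsto (fun n => ∫⁻ ω, negExp (g n ω) ∂P) Filter.atTop
      (nhds (∫⁻ ω, negExp (G ω) ∂P)) := by
  refine tendsto_lintegral_of_dominated_convergence (fun _ => 1)
    (fun n => measurable_negExp.comp (hg n)) (fun n => .of_forall fun ω => negExp_le_one _)
    (by simp) (.of_forall fun ω => (continuous_negExp.tendsto _).comp (h ω))

/-- The Laplace transform of the Poisson distribution. -/
lemma lintegral_negExp_poissonMeasure (r : ℝ≥0) (c : ℝ≥0∞) :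
    ∫⁻ x, negExp (c * x) ∂((poissonMeasure r).map (fun k : ℕ => (k : ℝ≥0∞)))
      = negExp ((1 - negExp c) * r) := by
  rw [lintegral_map (f := fun x => negExp (c * x))
      (measurable_negExp.comp (measurable_const_mul c)) .of_discrete,
    poissonMeasure, lintegral_sum_measure]
  obtain ⟨q, hq⟩ : ∃ q : ℝ≥0, (q : ℝ≥0∞) = negExp c :=
    ⟨_, ENNReal.coe_toNNReal (negExp_ne_top c)⟩
  have hq1 : q ≤ 1 := by
    have := negExp_le_one c
    rw [← hq] at this
    exact_mod_cast this
  have h1 : (1 - negExp c) * r = (((1 - q) * r : ℝ≥0) : ℝ≥0∞) := by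
    rw [← hq]; push_cast; rfl
  rw [h1, negExp_coe]
  simp only [lintegral_smul_measure, lintegral_dirac, negExp_mul_natCast, ← hq, smul_eq_mul]
  have h2 : ∀ n : ℕ, ENNReal.ofReal (Real.exp (-r) * r ^ n / (n.factorial)) * (q : ℝ≥0∞) ^ n
      = ENNReal.ofReal (Real.exp (-r) * ((r * q : ℝ) ^ n / (n.factorial))) := by
    intro n
    rw [← ENNReal.coe_pow, ← ENNReal.ofReal_coe_nnreal, ← ENNReal.ofReal_mul (by positivity)]
    congr 1
    push_cast
    rw [mul_pow]; ring
  simp only [h2]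
  have h3 := (NormedSpace.expSeries_div_hasSum_exp (r * q : ℝ)).mul_left (Real.exp (-r))
  rw [← ENNReal.ofReal_tsum_of_nonneg (fun n => by positivity) h3.summable, h3.tsum_eq,
    ← Real.exp_eq_exp_ℝ, ← Real.exp_add]
  congr 2
  push_cast [NNReal.coe_sub hq1]
  ring

/-! ### Uniqueness of Laplace transforms on [0, ∞]^ι. -/

section Uniqueness

open BoundedContinuousFunction

variable {ι : Type*} [Fintype ι]

/-- The coefficients are finite because multiplication by ∞ is discontinuous at 0. -/
lemma continuous_negExp_sum (c : ι → ℝ≥0) :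
    Continuous fun x : ι → ℝ≥0∞ => negExp (∑ i, c i * x i) :=
  continuous_negExp.comp (continuous_finsetSum _ fun i _ =>
    (ENNReal.continuous_const_mul ENNReal.coe_ne_top).comp (continuous_apply i))

/-- The function `x ↦ exp (-∑ i, c i * x i)` on `[0, ∞]^ι`. -/
noncomputable def laplaceBCF (c : ι → ℝ≥0) : (ι → ℝ≥0∞) →ᵇ ℝ :=
  BoundedContinuousFunction.ofNormedAddCommGroup
    (fun x => (negExp (∑ i, c i * x i)).toReal)
    (continuous_iff_continuousAt.2 fun x =>
      (ENNReal.tendsto_toReal (negExp_ne_top _)).comp (continuous_negExp_sum c).continuousAt) 1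
    (fun x => by
      rw [Real.norm_of_nonneg ENNReal.toReal_nonneg]
      exact ENNReal.toReal_le_of_le_ofReal zero_le_one (by simpa using negExp_le_one _))

lemma laplaceBCF_apply (c : ι → ℝ≥0) (x : ι → ℝ≥0∞) :
    laplaceBCF c x = (negExp (∑ i, c i * x i)).toReal := rfl

/-- The functions `laplaceBCF c` form a submonoid. -/
noncomputable def laplaceSubmonoid (ι : Type*) [Fintype ι] : Submonoid ((ι → ℝ≥0∞) →ᵇ ℝ) where
  carrier := range laplaceBCF
  one_mem' := ⟨0, by ext x; simp [laplaceBCF_apply, negExp_zero]⟩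
  mul_mem' := by
    rintro _ _ ⟨c, rfl⟩ ⟨d, rfl⟩
    refine ⟨c + d, ?_⟩
    ext x
    simp [laplaceBCF_apply, add_mul, Finset.sum_add_distrib, negExp_add]

/-- The algebra spanned by the functions `laplaceBCF c`. -/
noncomputable def laplaceAlgebra (ι : Type*) [Fintype ι] : StarSubalgebra ℝ ((ι → ℝ≥0∞) →ᵇ ℝ) where
  toSubalgebra := Algebra.adjoin ℝ (laplaceSubmonoid ι : Set ((ι → ℝ≥0∞) →ᵇ ℝ))
  star_mem' := by
    intro f hf
    have : star f = f := by ext x; simp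
    rwa [this]

/-- A finite measure on `[0, ∞]^ι` is determined by its Laplace transform. -/
lemma ext_of_lintegral_negExp {μ ν : Measure (ι → ℝ≥0∞)} [IsFiniteMeasure μ] [IsFiniteMeasure ν]
    (h : ∀ c : ι → ℝ≥0,
      ∫⁻ x, negExp (∑ i, c i * x i) ∂μ = ∫⁻ x, negExp (∑ i, c i * x i) ∂ν) : μ = ν := by
  classical
  have hbase : ∀ c : ι → ℝ≥0, ∫ x, laplaceBCF c x ∂μ = ∫ x, laplaceBCF c x ∂ν := by
    intro c
    simp only [laplaceBCF_apply]
    rw [integral_toReal (continuous_negExp_sum c).measurable.aemeasurable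
        (.of_forall fun x => (negExp_ne_top _).lt_top),
      integral_toReal (continuous_negExp_sum c).measurable.aemeasurable
        (.of_forall fun x => (negExp_ne_top _).lt_top), h c]
  refine ext_of_forall_mem_subalgebra_integral_eq_of_polish (𝕜 := ℝ) (A := laplaceAlgebra ι) ?_ ?_
  · intro x y hxy
    obtain ⟨i, hi⟩ := Function.ne_iff.1 hxy
    refine ⟨laplaceBCF (Pi.single i 1), ⟨laplaceBCF (Pi.single i 1),
      ⟨laplaceBCF (Pi.single i 1), Algebra.subset_adjoin ⟨_, rfl⟩, rfl⟩, rfl⟩, ?_⟩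
    have hs : ∀ z : ι → ℝ≥0∞, ∑ j, ((Pi.single i 1 : ι → ℝ≥0) j : ℝ≥0∞) * z j = z i := by
      intro z
      rw [Finset.sum_eq_single i] <;> simp +contextual
    rw [laplaceBCF_apply, laplaceBCF_apply, hs, hs]
    intro he
    exact hi (negExp_strictAnti.injective
      ((ENNReal.toReal_eq_toReal_iff' (negExp_ne_top _) (negExp_ne_top _)).1 he))
  · intro g hg
    -- The generators are closed under multiplication, so the algebra is their linear span and
    -- linearity of the integral suffices.
    replace hg : g ∈ Submodule.span ℝ (laplaceSubmonoid ι : Set ((ι → ℝ≥0∞) →ᵇ ℝ)) := by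
      have h1 : g ∈ Subalgebra.toSubmodule
        (Algebra.adjoin ℝ (laplaceSubmonoid ι : Set ((ι → ℝ≥0∞) →ᵇ ℝ))) := hg
      rwa [Algebra.adjoin_eq_span, Submonoid.closure_eq] at h1
    induction hg using Submodule.span_induction with
    | mem x hx => obtain ⟨c, rfl⟩ := hx; exact hbase c
    | zero => simp
    | add x y _ _ hx hy =>
      simp only [BoundedContinuousFunction.coe_add, Pi.add_apply]
      rw [integral_add (x.integrable μ) (y.integrable μ),
        integral_add (x.integrable ν) (y.integrable ν), hx, hy]
    | smul a x _ hx =>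
      simp only [BoundedContinuousFunction.coe_smul]
      rw [integral_smul, integral_smul, hx]

end Uniqueness

/-! ### Joint law of counts from the Laplace functional. -/

section LaplaceUniqueness

variable {Ω E : Type*} [MeasurableSpace Ω] [MeasurableSpace E] {P : Measure Ω} {N : Ω → Measure E}
  {Λ : Measure E}

/-- Test against f = ∑ c_i 1_{B_i}: since the sets are disjoint, 1 - e^{-f} is the step function
with values 1 - e^{-c_i}. -/
lemma lintegral_negExp_sum_of_laplace
    (h : ∀ f : E → ℝ≥0∞, Measurable f →
      ∫⁻ ω, negExp (∫⁻ x, f x ∂(N ω)) ∂P = negExp (∫⁻ x, (1 - negExp (f x)) ∂Λ))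
    {ι : Type*} [Fintype ι] (B : ι → Set E) (hB : ∀ i, MeasurableSet (B i))
    (hd : Pairwise fun i j => Disjoint (B i) (B j)) (c : ι → ℝ≥0) :
    ∫⁻ ω, negExp (∑ i, c i * N ω (B i)) ∂P = ∏ i, negExp ((1 - negExp (c i)) * Λ (B i)) := by
  classical
  let f : E → ℝ≥0∞ := fun x => ∑ i, (B i).indicator (fun _ => (c i : ℝ≥0∞)) x
  have hf : Measurable f := Finset.measurable_sum _ fun i _ => measurable_const.indicator (hB i)
  have h1 : ∀ μ : Measure E, ∫⁻ x, f x ∂μ = ∑ i, c i * μ (B i) := by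
    intro μ
    rw [lintegral_finsetSum _ fun i _ => measurable_const.indicator (hB i)]
    exact Finset.sum_congr rfl fun i _ => lintegral_indicator_const (hB i) _
  have h2 : ∀ x, 1 - negExp (f x) = ∑ i, (B i).indicator (fun _ => 1 - negExp (c i)) x := by
    intro x
    by_cases hx : ∃ i, x ∈ B i
    · obtain ⟨i, hi⟩ := hx
      have hn : ∀ j, j ≠ i → x ∉ B j := fun j hj hxj => disjoint_left.1 (hd hj) hxj hi
      simp only [f]
      rw [Finset.sum_eq_single i (fun j _ hj => indicator_of_notMem (hn j hj) _) (by simp),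
        Finset.sum_eq_single i (fun j _ hj => indicator_of_notMem (hn j hj) _) (by simp),
        indicator_of_mem hi, indicator_of_mem hi]
    · push Not at hx
      simp [f, hx, negExp_zero]
  have h3 := h f hf
  simp only [h1, h2] at h3
  rw [h3, lintegral_finsetSum _ fun i _ => measurable_const.indicator (hB i), negExp_sum]
  exact Finset.prod_congr rfl fun i _ => by rw [lintegral_indicator_const (hB i)]

lemma lintegral_negExp_sum_pi {ι : Type*} [Fintype ι] (μ : ι → Measure ℝ≥0∞)
    [∀ i, IsProbabilityMeasure (μ i)] (c : ι → ℝ≥0) :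
    ∫⁻ x, negExp (∑ i, c i * x i) ∂(Measure.pi μ) = ∏ i, ∫⁻ y, negExp (c i * y) ∂(μ i) := by
  have hm : ∀ i, Measurable fun y : ℝ≥0∞ => negExp (c i * y) := fun i =>
    measurable_negExp.comp (measurable_const_mul _)
  simp only [negExp_sum]
  rw [lintegral_prod_eq_prod_lintegral_of_indepFun Finset.univ
    (fun i (x : ι → ℝ≥0∞) => negExp (c i * x i))
    (iIndepFun_pi (X := fun i y => negExp (c i * y)) fun i => (hm i).aemeasurable)
    (fun i => (hm i).comp (measurable_pi_apply i))]
  refine Finset.prod_congr rfl fun i _ => ?_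
  exact (measurePreserving_eval μ i).lintegral_comp (hm i)

/-- The joint Laplace transform factorises into Poisson ones, which yields the marginal laws and the
independence of the counts at once. -/
lemma hasLaw_pi_of_laplace [IsProbabilityMeasure P]
    (hmeas : ∀ B : Set E, MeasurableSet B → Measurable fun ω => N ω B)
    (h : ∀ f : E → ℝ≥0∞, Measurable f →
      ∫⁻ ω, negExp (∫⁻ x, f x ∂(N ω)) ∂P = negExp (∫⁻ x, (1 - negExp (f x)) ∂Λ))
    {ι : Type*} [Fintype ι] (B : ι → Set E) (hB : ∀ i, MeasurableSet (B i))
    (hfin : ∀ i, Λ (B i) < ∞) (hd : Pairwise fun i j => Disjoint (B i) (B j)) :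
    HasLaw (fun ω i => N ω (B i)) (Measure.pi fun i =>
      (poissonMeasure (Λ (B i)).toNNReal).map (fun k : ℕ => (k : ℝ≥0∞))) P := by
  have hm : Measurable fun ω i => N ω (B i) := measurable_pi_lambda _ fun i => hmeas _ (hB i)
  refine ⟨hm.aemeasurable, ?_⟩
  have : IsProbabilityMeasure (P.map fun ω i => N ω (B i)) :=
    Measure.isProbabilityMeasure_map hm.aemeasurable
  refine ext_of_lintegral_negExp fun c => ?_
  rw [lintegral_map (continuous_negExp_sum c).measurable hm,
    lintegral_negExp_sum_of_laplace h B hB hd, lintegral_negExp_sum_pi]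
  refine Finset.prod_congr rfl fun i _ => ?_
  rw [lintegral_negExp_poissonMeasure, ENNReal.coe_toNNReal (hfin i).ne]

end LaplaceUniqueness

/-! ### The Laplace functional characterises Poisson processes. -/

section LaplaceFunctional

variable {Ω E : Type*} [MeasurableSpace Ω] [TopologicalSpace E] [MeasurableSpace E]
  {P : Measure Ω} {N : Ω → Measure E} {Λ : Measure E}

lemma IsPoissonPointProcess.measurable (hN : IsPoissonPointProcess P N Λ) : Measurable N :=
  Measure.measurable_of_measurable_coe _ hN.measurable_count

lemma IsPoissonPointProcess.iIndepFun_count (hN : IsPoissonPointProcess P N Λ) {ι : Type*}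
    [Fintype ι] (B : ι → Set E) (hB : ∀ i, MeasurableSet (B i)) (hfin : ∀ i, Λ (B i) < ∞)
    (hd : Pairwise fun i j => Disjoint (B i) (B j)) : iIndepFun (fun i ω => N ω (B i)) P := by
  let e := Fintype.equivFin ι
  have h := hN.indep _ (fun k => B (e.symm k)) (fun k => hB _) (fun k => hfin _)
    (fun i j hij => hd (fun h => hij (e.symm.injective h)))
  simpa using h.precomp e.injective

lemma IsPoissonPointProcess.lintegral_negExp_mul_count (hN : IsPoissonPointProcess P N Λ)
    {B : Set E} (hB : MeasurableSet B) (hfin : Λ B < ∞) (c : ℝ≥0∞) :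
    ∫⁻ ω, negExp (c * N ω B) ∂P = negExp ((1 - negExp c) * Λ B) := by
  rw [(hN.poisson B hB hfin).lintegral_comp (f := fun x => negExp (c * x))
    (measurable_negExp.comp (measurable_const_mul c)).aemeasurable, lintegral_negExp_poissonMeasure,
    ENNReal.coe_toNNReal hfin.ne]

lemma IsPoissonPointProcess.laplace_sum (hN : IsPoissonPointProcess P N Λ) {ι : Type*}
    [Fintype ι] (c : ι → ℝ≥0∞) (B : ι → Set E) (hB : ∀ i, MeasurableSet (B i))
    (hfin : ∀ i, Λ (B i) < ∞) (hd : Pairwise fun i j => Disjoint (B i) (B j)) :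
    ∫⁻ ω, negExp (∑ i, c i * N ω (B i)) ∂P = negExp (∑ i, (1 - negExp (c i)) * Λ (B i)) := by
  simp only [negExp_sum]
  have hm : ∀ i, Measurable fun x : ℝ≥0∞ => negExp (c i * x) := fun i =>
    measurable_negExp.comp (measurable_const_mul _)
  rw [lintegral_prod_eq_prod_lintegral_of_indepFun Finset.univ
    (fun i ω => negExp (c i * N ω (B i)))
    ((hN.iIndepFun_count B hB hfin hd).comp (fun i x => negExp (c i * x)) hm)
    (fun i => (hm i).comp (hN.measurable_count _ (hB i)))]
  exact Finset.prod_congr rfl fun i _ => hN.lintegral_negExp_mul_count (hB i) (hfin i) _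

lemma IsPoissonPointProcess.laplace_simpleFunc (hN : IsPoissonPointProcess P N Λ)
    (f : SimpleFunc E ℝ≥0∞) (hf : f.FinMeasSupp Λ) :
    ∫⁻ ω, negExp (∫⁻ x, f x ∂(N ω)) ∂P = negExp (∫⁻ x, (1 - negExp (f x)) ∂Λ) := by
  classical
  -- The zero level set is dropped: it may have infinite mean measure, and it contributes to neither
  -- integral.
  let s := f.range.filter (· ≠ 0)
  have h1 : ∀ (g : ℝ≥0∞ → ℝ≥0∞) (μ : Measure E), g 0 = 0 →
      ∫⁻ x, g (f x) ∂μ = ∑ c : s, g c * μ (f ⁻¹' {(c : ℝ≥0∞)}) := by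
    intro g μ hg
    have := SimpleFunc.map_lintegral (μ := μ) g f
    rw [← SimpleFunc.lintegral_eq_lintegral] at this
    simp only [SimpleFunc.coe_map, Function.comp_apply] at this
    rw [this, Finset.sum_coe_sort s (fun c => g c * μ (f ⁻¹' {c})), Finset.sum_filter]
    refine Finset.sum_congr rfl fun c _ => ?_
    split_ifs with hc
    · rfl
    · rw [not_not.1 hc, hg, zero_mul]
  have h2 := h1 (fun c => 1 - negExp c) Λ (by simp [negExp_zero])
  have h3 := fun ω => h1 id (N ω) rfl
  simp only [id] at h3
  simp only [h2, h3]
  refine hN.laplace_sum (fun c : s => (c : ℝ≥0∞)) (fun c : s => f ⁻¹' {(c : ℝ≥0∞)})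
    (fun c => f.measurableSet_fiber _) (fun c => ?_) (fun c d hcd => ?_)
  · exact SimpleFunc.finMeasSupp_iff.1 hf c (Finset.mem_filter.1 c.2).2
  · exact Disjoint.preimage _ (disjoint_singleton.2 fun h => hcd (Subtype.ext h))

/-- The Laplace functional of a Poisson point process. -/
theorem IsPoissonPointProcess.laplace [IsFiniteMeasure P] [SigmaFinite Λ]
    (hN : IsPoissonPointProcess P N Λ) {f : E → ℝ≥0∞} (hf : Measurable f) :
    ∫⁻ ω, negExp (∫⁻ x, f x ∂(N ω)) ∂P = negExp (∫⁻ x, (1 - negExp (f x)) ∂Λ) := by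
  classical
  -- Cutting off to the spanning sets gives each approximant a support of finite measure, while the
  -- sequence still increases to `f`.
  let g : ℕ → SimpleFunc E ℝ≥0∞ := fun n => (SimpleFunc.eapprox f n).restrict (spanningSets Λ n)
  have hg : ∀ n x, g n x = (spanningSets Λ n).indicator (SimpleFunc.eapprox f n) x := fun n x =>
    SimpleFunc.restrict_apply _ (measurableSet_spanningSets Λ n) x
  have hmono : Monotone fun n x => g n x := by
    intro m n hmn x
    simp only [hg]
    refine (indicator_le_indicator_of_subset (monotone_spanningSets Λ hmn) (fun _ => zero_le) x).trans
      (indicator_le_indicator (SimpleFunc.monotone_eapprox f hmn x))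
  have hlim : ∀ x, Filter.Tendsto (fun n => g n x) Filter.atTop (nhds (f x)) := by
    intro x
    have h1 : Filter.Tendsto (fun n => SimpleFunc.eapprox f n x) Filter.atTop (nhds (f x)) := by
      rw [← SimpleFunc.iSup_eapprox_apply hf x]
      exact tendsto_atTop_iSup fun m n h => SimpleFunc.monotone_eapprox f h x
    refine h1.congr' ?_
    obtain ⟨k, hk⟩ := mem_iUnion.1 (iUnion_spanningSets Λ ▸ mem_univ x)
    filter_upwards [Filter.eventually_ge_atTop k] with n hn
    rw [hg, indicator_of_mem (monotone_spanningSets Λ hn hk)]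
  have hsupp : ∀ n, (g n).FinMeasSupp Λ := by
    intro n
    rw [SimpleFunc.finMeasSupp_iff]
    intro y hy
    refine (measure_mono ?_).trans_lt (measure_spanningSets_lt_top Λ n)
    intro x hx
    by_contra hxn
    rw [mem_preimage, mem_singleton_iff, hg, indicator_of_notMem hxn] at hx
    exact hy hx.symm
  have hL : Filter.Tendsto (fun n => ∫⁻ ω, negExp (∫⁻ x, g n x ∂(N ω)) ∂P) Filter.atTop
      (nhds (∫⁻ ω, negExp (∫⁻ x, f x ∂(N ω)) ∂P)) := by
    refine tendsto_lintegral_negExp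
      (fun n => (Measure.measurable_lintegral (g n).measurable).comp hN.measurable) fun ω => ?_
    exact lintegral_tendsto_of_tendsto_of_monotone (fun n => (g n).measurable.aemeasurable)
      (.of_forall fun x m n h => hmono h x) (.of_forall hlim)
  have hR : Filter.Tendsto (fun n => negExp (∫⁻ x, (1 - negExp (g n x)) ∂Λ)) Filter.atTop
      (nhds (negExp (∫⁻ x, (1 - negExp (f x)) ∂Λ))) := by
    refine (continuous_negExp.tendsto _).comp ?_
    refine lintegral_tendsto_of_tendsto_of_monotone
      (fun n => ((measurable_negExp.comp (g n).measurable).const_sub 1).aemeasurable)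
      (.of_forall fun x m n h => tsub_le_tsub_left (negExp_strictAnti.antitone (hmono h x)) _)
      (.of_forall fun x => ?_)
    exact ENNReal.Tendsto.sub tendsto_const_nhds ((continuous_negExp.tendsto _).comp (hlim x))
      (.inl ENNReal.one_ne_top)
  refine tendsto_nhds_unique hL (hR.congr fun n => ?_)
  exact (hN.laplace_simpleFunc (g n) (hsupp n)).symm

/-- A point process with the Laplace functional of a Poisson point process is one. -/
theorem isPoissonPointProcess_of_laplace [IsProbabilityMeasure P] [T2Space E]
    [OpensMeasurableSpace E] [SigmaCompactSpace E] [WeaklyLocallyCompactSpace E]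
    (hΛ : ∀ K : Set E, IsCompact K → Λ K < ∞)
    (hmeas : ∀ B : Set E, MeasurableSet B → Measurable fun ω => N ω B)
    (hcount : ∀ ω, ∀ B : Set E, MeasurableSet B → ∃ k : ℕ∞, N ω B = (k : ℝ≥0∞))
    (h : ∀ f : E → ℝ≥0∞, Measurable f →
      ∫⁻ ω, negExp (∫⁻ x, f x ∂(N ω)) ∂P = negExp (∫⁻ x, (1 - negExp (f x)) ∂Λ)) :
    IsPoissonPointProcess P N Λ := by
  have hpois : ∀ B : Set E, MeasurableSet B → Λ B < ∞ → HasLaw (fun ω => N ω B)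
      ((poissonMeasure (Λ B).toNNReal).map (fun k : ℕ => (k : ℝ≥0∞))) P := by
    intro B hB hfin
    have h1 := hasLaw_pi_of_laplace (ι := Unit) hmeas h (fun _ => B) (fun _ => hB) (fun _ => hfin)
      (fun i j hij => (hij rfl).elim)
    exact (measurePreserving_eval _ ()).comp_hasLaw h1
  refine ⟨hΛ, hmeas, .of_forall hcount, ?_, hpois, ?_⟩
  · let K := CompactExhaustion.choice E
    -- Almost sure finiteness is needed for all compact sets simultaneously; a countable exhaustion
    -- reduces this to countably many null events.
    have h1 : ∀ᵐ ω ∂P, ∀ n, N ω (K n) < ∞ := by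
      refine ae_all_iff.2 fun n => ?_
      have hl := hpois (K n) (K.isCompact n).measurableSet (hΛ _ (K.isCompact n))
      refine (hl.ae_iff (p := fun x => x < ∞) (measurableSet_Iio).mem).2 ?_
      rw [ae_map_iff .of_discrete measurableSet_Iio]
      exact .of_forall fun k => by simp
    filter_upwards [h1] with ω hω C hC
    obtain ⟨n, hn⟩ := K.exists_superset_of_isCompact hC
    exact (measure_mono hn).trans_lt (hω n)
  · intro k B hB hfin hd
    exact (iIndepFun_iff_hasLaw_pi_pi fun i => hpois (B i) (hB i) (hfin i)).2
      (hasLaw_pi_of_laplace hmeas h B hB hfin hd)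

end LaplaceFunctional

/-! ### Counts and integrals for point measures. -/

section PointMeasure

variable {E : Type*} [MeasurableSpace E]

open Classical in
lemma pointMeasure_apply (keep : ℕ → Prop) (x : ℕ → E) {B : Set E} (hB : MeasurableSet B) :
    pointMeasure keep x B = ∑' n, if keep n ∧ x n ∈ B then 1 else 0 := by
  rw [pointMeasure, Measure.sum_apply _ hB]
  refine tsum_congr fun n => ?_
  by_cases h : keep n <;> simp [h, Measure.dirac_apply' _ hB, indicator_apply]

open Classical in
lemma lintegral_pointMeasure (keep : ℕ → Prop) (x : ℕ → E) {f : E → ℝ≥0∞} (hf : Measurable f) :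
    ∫⁻ y, f y ∂(pointMeasure keep x) = ∑' n, if keep n then f (x n) else 0 := by
  rw [pointMeasure, lintegral_sum_measure]
  refine tsum_congr fun n => ?_
  split_ifs with h
  · exact lintegral_dirac' _ hf
  · simp

lemma exists_enat_tsum_ite (q : ℕ → Prop) [DecidablePred q] :
    ∃ k : ℕ∞, (∑' n, if q n then (1 : ℝ≥0∞) else 0) = (k : ℝ≥0∞) := by
  refine ⟨ENat.card {n // q n}, ?_⟩
  have h1 := tsum_subtype {n | q n} (fun _ => (1 : ℝ≥0∞))
  simp only [indicator_apply, mem_ofPred_eq] at h1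
  rw [← h1, ENNReal.tsum_const, mul_one]
  rfl

lemma pointMeasure_apply_eq_enat (keep : ℕ → Prop) (x : ℕ → E) {B : Set E} (hB : MeasurableSet B) :
    ∃ k : ℕ∞, pointMeasure keep x B = (k : ℝ≥0∞) := by
  classical
  rw [pointMeasure_apply keep x hB]
  exact exists_enat_tsum_ite _

end PointMeasure

/-! ### Marking, thinning and mapping. -/

section Marking

variable {Ω E M F : Type*} [MeasurableSpace Ω] [TopologicalSpace E] [MeasurableSpace E]
  [MeasurableSpace M] [TopologicalSpace F] [MeasurableSpace F]
  {P : Measure Ω} [IsProbabilityMeasure P] {X : ℕ → Ω → E} {m : ℕ → Ω → M} {ν : Measure M}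

/-- Averaging over i.i.d. marks independent of the positions. -/
lemma lintegral_prod_marks {E : Type*} [MeasurableSpace E] {X : ℕ → Ω → E}
    (hX : ∀ n, Measurable (X n)) (hm : ∀ n, Measurable (m n))
    (hXm : IndepFun (fun ω n => X n ω) (fun ω n => m n ω) P) (hind : iIndepFun m P)
    (hlaw : ∀ n, P.map (m n) = ν) {u : E × M → ℝ≥0∞} (hu : Measurable u) (K : ℕ) :
    ∫⁻ ω, ∏ n ∈ Finset.range K, u (X n ω, m n ω) ∂P
      = ∫⁻ ω, ∏ n ∈ Finset.range K, ∫⁻ z, u (X n ω, z) ∂ν ∂P := by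
  have hX' : Measurable fun ω n => X n ω := measurable_pi_lambda _ hX
  have hm' : Measurable fun ω n => m n ω := measurable_pi_lambda _ hm
  have : IsProbabilityMeasure (P.map fun ω n => m n ω) :=
    Measure.isProbabilityMeasure_map hm'.aemeasurable
  have : IsProbabilityMeasure (P.map (m 0)) :=
    Measure.isProbabilityMeasure_map (hm 0).aemeasurable
  have hν : IsProbabilityMeasure ν := hlaw 0 ▸ this
  have hG : Measurable fun q : (ℕ → E) × (ℕ → M) => ∏ n ∈ Finset.range K, u (q.1 n, q.2 n) := by
    fun_prop
  have hprod := (indepFun_iff_map_prod_eq_prod_map_map hX'.aemeasurable hm'.aemeasurable).1 hXm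
  -- The joint law of positions and marks is a product, so by Fubini the positions can be frozen
  -- while the marks are averaged.
  have h1 : ∫⁻ ω, ∏ n ∈ Finset.range K, u (X n ω, m n ω) ∂P
      = ∫⁻ x, ∫⁻ ω, ∏ n ∈ Finset.range K, u (x n, m n ω) ∂P ∂(P.map fun ω n => X n ω) := by
    rw [← lintegral_map (f := fun q : (ℕ → E) × (ℕ → M) => ∏ n ∈ Finset.range K, u (q.1 n, q.2 n))
      hG (hX'.prodMk hm'), hprod, lintegral_prod _ hG.aemeasurable]
    refine lintegral_congr fun x => ?_
    exact lintegral_map (hG.comp measurable_prodMk_left) hm'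
  have h2 : ∀ x : ℕ → E, ∫⁻ ω, ∏ n ∈ Finset.range K, u (x n, m n ω) ∂P
      = ∏ n ∈ Finset.range K, ∫⁻ z, u (x n, z) ∂ν := by
    intro x
    have hux : ∀ n, Measurable fun z => u (x n, z) := fun n => hu.comp measurable_prodMk_left
    rw [lintegral_prod_eq_prod_lintegral_of_indepFun _ (fun n ω => u (x n, m n ω))
      (hind.comp (fun n z => u (x n, z)) hux) (fun n => (hux n).comp (hm n))]
    refine Finset.prod_congr rfl fun n _ => ?_
    rw [← hlaw n, lintegral_map (hux n) (hm n)]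
  have hu' : Measurable fun y : E => ∫⁻ z, u (y, z) ∂ν := hu.lintegral_prod_right'
  simp only [h1, h2]
  rw [lintegral_map (by fun_prop) hX']

/-- Put g(x) = -log ∫ e^{-f(x, z)} dν(z). Averaging over the marks turns the functional of the
marked process at f into that of the unmarked process at g, and 1 - e^{-g(x)} = ∫ (1 - e^{-f(x, z)})
dν(z). -/
lemma laplace_marked {Λ : Measure E} [SigmaFinite Λ]
    (hN : IsPoissonPointProcess P (fun ω => pointMeasure (fun _ => True) fun n => X n ω) Λ)
    (hX : ∀ n, Measurable (X n)) (hm : ∀ n, Measurable (m n))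
    (hXm : IndepFun (fun ω n => X n ω) (fun ω n => m n ω) P) (hind : iIndepFun m P)
    (hlaw : ∀ n, P.map (m n) = ν) {f : E × M → ℝ≥0∞} (hf : Measurable f) :
    ∫⁻ ω, negExp (∑' n, f (X n ω, m n ω)) ∂P
      = negExp (∫⁻ q, (1 - negExp (f q)) ∂(Λ.prod ν)) := by
  have : IsProbabilityMeasure (P.map (m 0)) :=
    Measure.isProbabilityMeasure_map (hm 0).aemeasurable
  have hν : IsProbabilityMeasure ν := hlaw 0 ▸ this
  let u : E × M → ℝ≥0∞ := fun q => negExp (f q)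
  have hu : Measurable u := measurable_negExp.comp hf
  let G : E → ℝ≥0∞ := fun x => ∫⁻ z, u (x, z) ∂ν
  have hG : Measurable G := hu.lintegral_prod_right'
  have hG1 : ∀ x, G x ≤ 1 := fun x =>
    (lintegral_mono fun z => negExp_le_one _).trans (by simp)
  let g : E → ℝ≥0∞ := fun x => negLog (G x)
  have hg : Measurable g := measurable_negLog.comp hG
  have hgG : ∀ x, negExp (g x) = G x := fun x => negExp_negLog (hG1 x)
  -- Independence of the marks is used on finite products only; the full sums are reached by letting
  -- `K` tend to infinity.
  have hpartial : ∀ K, ∫⁻ ω, negExp (∑ n ∈ Finset.range K, f (X n ω, m n ω)) ∂P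
      = ∫⁻ ω, negExp (∑ n ∈ Finset.range K, g (X n ω)) ∂P := by
    intro K
    simp only [negExp_sum, hgG]
    exact lintegral_prod_marks hX hm hXm hind hlaw hu K
  have hl1 := tendsto_lintegral_negExp (P := P)
    (g := fun K ω => ∑ n ∈ Finset.range K, f (X n ω, m n ω))
    (fun K => by fun_prop) (fun ω => ENNReal.tendsto_nat_tsum _)
  have hl2 := tendsto_lintegral_negExp (P := P)
    (g := fun K ω => ∑ n ∈ Finset.range K, g (X n ω))
    (fun K => by fun_prop) (fun ω => ENNReal.tendsto_nat_tsum _)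
  rw [tendsto_nhds_unique hl1 (hl2.congr fun K => (hpartial K).symm)]
  have h1 := hN.laplace hg
  simp only [lintegral_pointMeasure _ _ hg, if_true] at h1
  rw [h1, lintegral_prod _ (hu.const_sub 1).aemeasurable]
  congr 1
  refine lintegral_congr fun x => ?_
  rw [hgG]
  have h2 := lintegral_sub (μ := ν) (f := fun _ => (1 : ℝ≥0∞)) (g := fun z => u (x, z))
    (hu.comp measurable_prodMk_left) (((hG1 x).trans_lt ENNReal.one_lt_top).ne)
    (.of_forall fun z => negExp_le_one _)
  rw [h2]
  simp [G]

/-- The marking and mapping theorem: thin a Poisson point process according to i.i.d. marks that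
are independent of the positions, and map the retained points and their marks. -/
theorem isPoissonPointProcess_marked [T2Space F] [OpensMeasurableSpace F] [SigmaCompactSpace F]
    [WeaklyLocallyCompactSpace F] {Λ : Measure E} [SigmaFinite Λ]
    (hN : IsPoissonPointProcess P (fun ω => pointMeasure (fun _ => True) fun n => X n ω) Λ)
    (hX : ∀ n, Measurable (X n)) (hm : ∀ n, Measurable (m n))
    (hXm : IndepFun (fun ω n => X n ω) (fun ω n => m n ω) P) (hind : iIndepFun m P)
    (hlaw : ∀ n, P.map (m n) = ν) {K : Set (E × M)} (hK : MeasurableSet K) {φ : E × M → F}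
    (hφ : Measurable φ)
    (hfin : ∀ C : Set F, IsCompact C → (((Λ.prod ν).restrict K).map φ) C < ∞) :
    IsPoissonPointProcess P
      (fun ω => pointMeasure (fun n => (X n ω, m n ω) ∈ K) fun n => φ (X n ω, m n ω))
      (((Λ.prod ν).restrict K).map φ) := by
  classical
  have hXmn : ∀ n, Measurable fun ω => (X n ω, m n ω) := fun n => (hX n).prodMk (hm n)
  refine isPoissonPointProcess_of_laplace hfin (fun B hB => ?_)
    (fun ω B hB => pointMeasure_apply_eq_enat _ _ hB) fun f hf => ?_
  · simp only [pointMeasure_apply _ _ hB]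
    refine Measurable.tsum fun n => Measurable.ite ?_ measurable_const measurable_const
    exact (hXmn n hK).inter ((hφ.comp (hXmn n)) hB)
  -- Discarded points are encoded by the value 0 of the test function, where 1 - e^{-0} = 0
  -- contributes nothing to the mean.
  · have h1 : ∀ ω, ∫⁻ y, f y ∂(pointMeasure (fun n => (X n ω, m n ω) ∈ K)
        fun n => φ (X n ω, m n ω)) = ∑' n, K.indicator (f ∘ φ) (X n ω, m n ω) := by
      intro ω
      rw [lintegral_pointMeasure _ _ hf]
      exact tsum_congr fun n => by simp [indicator_apply]
    simp only [h1]
    rw [laplace_marked hN hX hm hXm hind hlaw ((hf.comp hφ).indicator hK),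
      lintegral_map (f := fun y => 1 - negExp (f y)) ((measurable_negExp.comp hf).const_sub 1) hφ, ← lintegral_indicator hK]
    congr 1
    refine lintegral_congr fun q => ?_
    by_cases hq : q ∈ K <;> simp [hq, negExp_zero]

end Marking

/-! ### Gaussian tails and tilting. -/

section Gaussian

lemma gaussQ_nonneg (x : ℝ) : 0 ≤ gaussQ x := measureReal_nonneg

lemma ofReal_gaussQ (x : ℝ) : ENNReal.ofReal (gaussQ x) = gaussianReal 0 1 (Ioi x) :=
  ofReal_measureReal

lemma gaussianReal_eq_map_standard (μ ξ : ℝ) :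
    gaussianReal μ (ξ ^ 2).toNNReal = (gaussianReal 0 1).map fun x => ξ * x + μ := by
  have h : (fun x => ξ * x + μ) = (fun x => x + μ) ∘ fun x : ℝ => ξ * x := rfl
  rw [h, ← Measure.map_map (by fun_prop) (by fun_prop), gaussianReal_map_const_mul,
    gaussianReal_map_add_const]
  congr 1
  · simp
  · ext; simp [sq_nonneg]

lemma gaussianReal_Ioi (μ : ℝ) {ξ : ℝ} (hξ : 0 < ξ) (w : ℝ) :
    gaussianReal μ (ξ ^ 2).toNNReal (Ioi w) = ENNReal.ofReal (gaussQ ((w - μ) / ξ)) := by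
  rw [gaussianReal_eq_map_standard, Measure.map_apply (by fun_prop) measurableSet_Ioi,
    ofReal_gaussQ]
  congr 1
  ext x
  simp only [mem_preimage, mem_Ioi, div_lt_iff₀ hξ]
  constructor <;> intro h <;> linarith

lemma gaussianReal_Iic {ξ : ℝ} (hξ : 0 < ξ) (w : ℝ) :
    gaussianReal 0 (ξ ^ 2).toNNReal (Iic w) = ENNReal.ofReal (gaussQ (-w / ξ)) := by
  have hv : (ξ ^ 2).toNNReal ≠ 0 := by simp [hξ.ne']
  have := nullSingletonClass_gaussianReal (μ := 0) hv
  have h1 := gaussianReal_Ioi 0 hξ (-w)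
  rw [sub_zero] at h1
  rw [← h1, measure_congr (Ioi_ae_eq_Ici (μ := gaussianReal 0 (ξ ^ 2).toNNReal) (a := -w))]
  conv_rhs => rw [← neg_zero, ← gaussianReal_map_neg]
  rw [Measure.map_apply (by fun_prop) measurableSet_Ici]
  congr 1
  ext x
  simp

/-- Exponential tilting of a centred Gaussian. -/
lemma setLIntegral_exp_gaussianReal (c : ℝ) {v : ℝ≥0} (hv : v ≠ 0) {A : Set ℝ}
    (hA : MeasurableSet A) :
    ∫⁻ z in A, ENNReal.ofReal (Real.exp (-c * z)) ∂(gaussianReal 0 v)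
      = ENNReal.ofReal (Real.exp (c ^ 2 * v / 2)) * gaussianReal (-c * v) v A := by
  rw [gaussianReal_apply _ hv, gaussianReal_of_var_ne_zero _ hv,
    setLIntegral_withDensity_eq_setLIntegral_mul _ (measurable_gaussianPDF 0 v) (by fun_prop) hA,
    ← lintegral_const_mul _ (measurable_gaussianPDF _ _)]
  refine lintegral_congr fun z => ?_
  rw [Pi.mul_apply, gaussianPDF_def, gaussianPDF_def, ← ENNReal.ofReal_mul
    (gaussianPDFReal_nonneg _ _ _), ← ENNReal.ofReal_mul (Real.exp_nonneg _), gaussianPDFReal_def,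
    gaussianPDFReal_def]
  congr 1
  -- What remains is completing the square in the exponent.
  have hv' : (v : ℝ) ≠ 0 := by exact_mod_cast hv
  simp only
  rw [mul_assoc, ← Real.exp_add, mul_left_comm, ← Real.exp_add]
  congr 2
  field_simp
  ring

end Gaussian

/-! ### Moments of the lognormal shadowing factor. -/

section Shadowing

variable {D β α ξ t : ℝ}

lemma shadowFactor_pos (β z : ℝ) : 0 < shadowFactor β z := Real.rpow_pos_of_pos (by norm_num) _

lemma shadowFactor_eq_exp (β z : ℝ) :
    shadowFactor β z = Real.exp (logMean β - 0.1 * Real.log 10 * z) := by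
  rw [shadowFactor, Real.rpow_def_of_pos (by norm_num), logMean]
  congr 1
  ring

lemma measurable_shadowFactor (β : ℝ) : Measurable (shadowFactor β) := by
  have : shadowFactor β = fun z => Real.exp (logMean β - 0.1 * Real.log 10 * z) :=
    funext (shadowFactor_eq_exp β)
  rw [this]
  fun_prop

lemma mul_shadowFactor_rpow (ht : 0 < t) (z : ℝ) :
    (t * shadowFactor β z) ^ (2 / α)
      = Real.exp ((Real.log t + logMean β - 0.1 * Real.log 10 * z) * (2 / α)) := by
  rw [Real.exp_mul, add_sub_assoc, Real.exp_add, Real.exp_log ht, shadowFactor_eq_exp]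

lemma mul_shadowFactor_rpow_eq_mul (ht : 0 < t) (z : ℝ) :
    (t * shadowFactor β z) ^ (2 / α)
      = t ^ (2 / α) * Real.exp (2 * logMean β / α)
        * Real.exp (-(2 * (0.1 * Real.log 10) / α) * z) := by
  rw [mul_shadowFactor_rpow ht, Real.rpow_def_of_pos ht, ← Real.exp_add, ← Real.exp_add]
  congr 1
  ring

lemma logStd_pos (hξ : 0 < ξ) : 0 < logStd ξ := by
  have := Real.log_pos (show (1 : ℝ) < 10 by norm_num)
  unfold logStd; positivity

/-- The shadowing factor decreases in `z`, so after taking logarithms the condition is an upper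
bound on `z`. This locates where the minimum of the two areas switches. -/
lemma sq_le_mul_shadowFactor_rpow_iff (hD : 0 < D) (hα : 0 < α) (hξ : 0 < ξ) (ht : 0 < t)
    (z : ℝ) :
    D ^ 2 ≤ (t * shadowFactor β z) ^ (2 / α) ↔ z ≤ -(upsilon D β α ξ t * ξ) := by
  have ha := Real.log_pos (show (1 : ℝ) < 10 by norm_num)
  have h1 : D ^ 2 = Real.exp (α * Real.log D * (2 / α)) := by
    have : α * Real.log D * (2 / α) = Real.log D * 2 := by field_simp
    rw [this, Real.exp_mul, Real.exp_log hD]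
    norm_cast
  have h2 : upsilon D β α ξ t * ξ
      = (α * Real.log D - Real.log t - logMean β) / (0.1 * Real.log 10) := by
    rw [upsilon, Real.log_div (Real.rpow_pos_of_pos hD _).ne' ht.ne', Real.log_rpow hD, logStd]
    field_simp
  rw [h1, mul_shadowFactor_rpow ht, Real.exp_le_exp, mul_le_mul_iff_left₀ (by positivity), h2,
    le_neg, div_le_iff₀ (by positivity)]
  constructor <;> intro h <;> linarith

/-- Exponential tilting with c = 2 (0.1 log 10) / α. Since c ξ = 2σ/α, the factor exp(c² ξ² / 2) is
exp(2σ²/α²), and the mean moves to -c ξ². -/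
lemma setLIntegral_mul_shadowFactor_rpow (hξ : 0 < ξ) (ht : 0 < t) {A : Set ℝ}
    (hA : MeasurableSet A) :
    ∫⁻ z in A, ENNReal.ofReal ((t * shadowFactor β z) ^ (2 / α))
        ∂(gaussianReal 0 (ξ ^ 2).toNNReal)
      = ENNReal.ofReal (t ^ (2 / α)
          * Real.exp (2 * logStd ξ ^ 2 / α ^ 2 + 2 * logMean β / α))
        * gaussianReal (-(2 * (0.1 * Real.log 10) / α) * ξ ^ 2) (ξ ^ 2).toNNReal A := by
  have hv : (ξ ^ 2).toNNReal ≠ 0 := by simp [hξ.ne']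
  have hv' : ((ξ ^ 2).toNNReal : ℝ) = ξ ^ 2 := Real.coe_toNNReal _ (sq_nonneg _)
  have h0 : 0 ≤ t ^ (2 / α) * Real.exp (2 * logMean β / α) := by positivity
  simp only [mul_shadowFactor_rpow_eq_mul ht, ENNReal.ofReal_mul h0]
  rw [lintegral_const_mul _ (by fun_prop), setLIntegral_exp_gaussianReal _ hv hA, hv', ← mul_assoc,
    ← ENNReal.ofReal_mul h0, mul_assoc (t ^ (2 / α)), ← Real.exp_add]
  congr 4
  rw [logStd]
  ring

/-- The `2 / α`-th moment of the shadowing factor. -/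
lemma lintegral_mul_shadowFactor_rpow (hξ : 0 < ξ) (ht : 0 < t) :
    ∫⁻ z, ENNReal.ofReal ((t * shadowFactor β z) ^ (2 / α)) ∂(gaussianReal 0 (ξ ^ 2).toNNReal)
      = ENNReal.ofReal (t ^ (2 / α)
          * Real.exp (2 * logStd ξ ^ 2 / α ^ 2 + 2 * logMean β / α)) := by
  have := setLIntegral_mul_shadowFactor_rpow (β := β) (α := α) hξ ht MeasurableSet.univ
  simpa using this

/-- The truncated `2 / α`-th moment of the shadowing factor. -/
lemma lintegral_min_mul_shadowFactor_rpow (hD : 0 < D) (hα : 0 < α) (hξ : 0 < ξ) (ht : 0 < t) :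
    ∫⁻ z, ENNReal.ofReal (min (D ^ 2) ((t * shadowFactor β z) ^ (2 / α)))
        ∂(gaussianReal 0 (ξ ^ 2).toNNReal)
      = ENNReal.ofReal (D ^ 2 * gaussQ (upsilon D β α ξ t)
          + t ^ (2 / α) * Real.exp (2 * logStd ξ ^ 2 / α ^ 2 + 2 * logMean β / α)
            * gaussQ (2 * logStd ξ ^ 2 / (α * logStd ξ) - upsilon D β α ξ t)) := by
  have hs := logStd_pos hξ
  set w := -(upsilon D β α ξ t * ξ) with hw
  have hiff := sq_le_mul_shadowFactor_rpow_iff (β := β) hD hα hξ ht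
  have h1 : ∫⁻ z in Iic w, ENNReal.ofReal (min (D ^ 2) ((t * shadowFactor β z) ^ (2 / α)))
      ∂(gaussianReal 0 (ξ ^ 2).toNNReal) = ENNReal.ofReal (D ^ 2 * gaussQ (upsilon D β α ξ t)) := by
    rw [setLIntegral_congr_fun (g := fun _ => ENNReal.ofReal (D ^ 2)) measurableSet_Iic
      (fun z hz => by simp only [min_eq_left ((hiff z).2 hz)]), setLIntegral_const,
      gaussianReal_Iic hξ, ← ENNReal.ofReal_mul (sq_nonneg D), hw]
    congr 3
    field_simp
  have h2 : ∫⁻ z in Ioi w, ENNReal.ofReal (min (D ^ 2) ((t * shadowFactor β z) ^ (2 / α)))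
      ∂(gaussianReal 0 (ξ ^ 2).toNNReal)
      = ENNReal.ofReal (t ^ (2 / α) * Real.exp (2 * logStd ξ ^ 2 / α ^ 2 + 2 * logMean β / α)
          * gaussQ (2 * logStd ξ ^ 2 / (α * logStd ξ) - upsilon D β α ξ t)) := by
    rw [setLIntegral_congr_fun (g := fun z => ENNReal.ofReal ((t * shadowFactor β z) ^ (2 / α)))
      measurableSet_Ioi (fun z hz => by
        simp only [min_eq_right (not_le.1 (mt (hiff z).1 (not_le.2 hz))).le]),
      setLIntegral_mul_shadowFactor_rpow hξ ht measurableSet_Ioi, gaussianReal_Ioi _ hξ,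
      ← ENNReal.ofReal_mul (by positivity), hw]
    congr 3
    -- Standardising `w` under the tilted mean gives (w + c ξ²)/ξ = 2σ/α - Υ.
    rw [show 2 * logStd ξ ^ 2 / (α * logStd ξ) = 2 * logStd ξ / α by field_simp, logStd]
    field_simp
    ring
  rw [← lintegral_add_compl _ (measurableSet_Iic (a := w)), compl_Iic, h1, h2,
    ← ENNReal.ofReal_add]
  · exact mul_nonneg (sq_nonneg _) (gaussQ_nonneg _)
  · exact mul_nonneg (by positivity) (gaussQ_nonneg _)

end Shadowing

/-! ### Areas of the regions of small propagation loss. -/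

section Geometry

variable {D β α : ℝ}

lemma propLoss_lt_iff (hα : 0 < α) (z : ℝ) (y : Plane) (t : ℝ≥0) :
    propLoss α β z y < t ↔ ‖y‖ < (t * shadowFactor β z) ^ α⁻¹ := by
  have hS := shadowFactor_pos β z
  rw [Real.lt_rpow_inv_iff_of_pos (norm_nonneg y) (by positivity) hα, ← div_lt_iff₀ hS]
  exact Iff.rfl

lemma sq_rpow_inv {x : ℝ} (hx : 0 ≤ x) : (x ^ α⁻¹) ^ 2 = x ^ (2 / α) := by
  rw [← Real.rpow_natCast, ← Real.rpow_mul hx]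
  congr 1
  push_cast
  ring

lemma volume_propLoss_lt (hα : 0 < α) (z : ℝ) (t : ℝ≥0) :
    volume {y : Plane | propLoss α β z y < t}
      = ENNReal.ofReal (Real.pi * (t * shadowFactor β z) ^ (2 / α)) := by
  have hS := shadowFactor_pos β z
  have h : {y : Plane | propLoss α β z y < t}
      = Metric.ball 0 ((t * shadowFactor β z) ^ α⁻¹) := by
    ext y
    rw [mem_ball_zero_iff]
    exact propLoss_lt_iff hα z y t
  rw [h, EuclideanSpace.volume_ball_fin_two, ← ENNReal.ofReal_pow (by positivity),
    sq_rpow_inv (by positivity), mul_comm, ENNReal.ofReal_mul Real.pi_pos.le]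

/-- The region is the intersection of two concentric discs, hence the smaller one. -/
lemma volume_norm_le_propLoss_lt (hD : 0 < D) (hα : 0 < α) (z : ℝ) (t : ℝ≥0) :
    volume {y : Plane | ‖y‖ ≤ D ∧ propLoss α β z y < t}
      = ENNReal.ofReal (Real.pi * min (D ^ 2) ((t * shadowFactor β z) ^ (2 / α))) := by
  have hS := shadowFactor_pos β z
  have hr : 0 ≤ (t * shadowFactor β z) ^ α⁻¹ := by positivity
  rcases le_or_gt ((t * shadowFactor β z) ^ α⁻¹) D with h | h
  · rw [min_eq_right, ← volume_propLoss_lt hα]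
    · congr 1
      ext y
      exact ⟨fun hy => hy.2, fun hy => ⟨((propLoss_lt_iff hα z y t).1 hy).le.trans h, hy⟩⟩
    · rw [← sq_rpow_inv (by positivity)]
      exact pow_le_pow_left₀ hr h 2
  · have h1 : {y : Plane | ‖y‖ ≤ D ∧ propLoss α β z y < t} = Metric.closedBall 0 D := by
      ext y
      rw [mem_closedBall_zero_iff]
      exact ⟨fun hy => hy.1, fun hy => ⟨hy, (propLoss_lt_iff hα z y t).2 (hy.trans_lt h)⟩⟩
    rw [h1, EuclideanSpace.volume_closedBall_fin_two, ← ENNReal.ofReal_pow hD.le, min_eq_left,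
      mul_comm, ENNReal.ofReal_mul Real.pi_pos.le]
    rw [← sq_rpow_inv (by positivity)]
    exact pow_le_pow_left₀ hD.le h.le 2

lemma volume_propLoss_eq (hα : 0 < α) (z : ℝ) (t : ℝ≥0) :
    volume {y : Plane | propLoss α β z y = t} = 0 := by
  have hS := shadowFactor_pos β z
  refine measure_mono_null ?_ (Measure.addHaar_sphere volume (0 : Plane)
    ((t * shadowFactor β z) ^ α⁻¹))
  intro y hy
  have h : ‖y‖ ^ α / shadowFactor β z = t := congrArg NNReal.toReal hy
  rw [mem_sphere_zero_iff_norm, ← h, div_mul_cancel₀ _ hS.ne', Real.rpow_rpow_inv (norm_nonneg y) hα.ne']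

end Geometry

/-! ### Mean measures of the loss processes. -/

section Means

variable {lam p D β α ξ : ℝ} {ν : Measure (Bool × ℝ × ℝ)} [IsProbabilityMeasure ν]
  {ζ : Bool × ℝ × ℝ → ℝ}

instance (lam : ℝ) : SigmaFinite (ENNReal.ofReal lam • (volume : Measure Plane)) :=
  inferInstanceAs (SigmaFinite (lam.toNNReal • (volume : Measure Plane)))

lemma measurableSet_isLOS (D : ℝ) :
    MeasurableSet {q : Plane × Bool × ℝ × ℝ | IsLOS D q.2.1 q.1} := by
  refine MeasurableSet.inter ?_ ?_
  · exact measurableSet_eq_fun (f := fun q : Plane × Bool × ℝ × ℝ => q.2.1) (by fun_prop)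
      measurable_const
  · exact measurableSet_le (f := fun q : Plane × Bool × ℝ × ℝ => ‖q.1‖) (by fun_prop)
      measurable_const

lemma measurable_propLoss_mark (α β : ℝ) (hζ : Measurable ζ) :
    Measurable fun q : Plane × Bool × ℝ × ℝ => propLoss α β (ζ q.2) q.1 := by
  refine Measurable.subtype_mk ?_
  exact (measurable_fst.norm.pow_const α).div
    ((measurable_shadowFactor β).comp (hζ.comp measurable_snd))

lemma measurableSet_propLoss_lt (α β : ℝ) (hζ : Measurable ζ) (t : ℝ≥0) :
    MeasurableSet {q : Plane × Bool × ℝ × ℝ | propLoss α β (ζ q.2) q.1 < t} :=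
  measurable_propLoss_mark α β hζ measurableSet_Iio

lemma measurableSet_isLOS_and_propLoss_lt (D α β : ℝ) (hζ : Measurable ζ) (t : ℝ≥0) :
    MeasurableSet {q : Plane × Bool × ℝ × ℝ | IsLOS D q.2.1 q.1 ∧ propLoss α β (ζ q.2) q.1 < t} :=
  (measurableSet_isLOS D).inter (measurableSet_propLoss_lt α β hζ t)

/-- The mean number of stations with small propagation loss in the absence of blockage. -/
lemma prod_propLoss_lt (hlam : 0 < lam) (hα : 0 < α) (hξ : 0 < ξ) (hζ : Measurable ζ)
    (hlaw : ν.map ζ = gaussianReal 0 (ξ ^ 2).toNNReal) {t : ℝ≥0} (ht : 0 < t) :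
    ((ENNReal.ofReal lam • (volume : Measure Plane)).prod ν)
        {q | propLoss α β (ζ q.2) q.1 < t}
      = ENNReal.ofReal (lam * (Real.pi * (t ^ (2 / α)
          * Real.exp (2 * logStd ξ ^ 2 / α ^ 2 + 2 * logMean β / α)))) := by
  have ht' : (0 : ℝ) < t := ht
  have hm : Measurable fun z => ENNReal.ofReal ((t * shadowFactor β z) ^ (2 / α)) :=
    (((measurable_shadowFactor β).const_mul _).pow_const _).ennreal_ofReal
  rw [Measure.prod_apply_symm (measurableSet_propLoss_lt α β hζ t)]
  have h1 : ∀ m, (ENNReal.ofReal lam • (volume : Measure Plane))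
      ((fun x => (x, m)) ⁻¹' {q : Plane × Bool × ℝ × ℝ | propLoss α β (ζ q.2) q.1 < t})
      = ENNReal.ofReal (lam * Real.pi)
        * ENNReal.ofReal ((t * shadowFactor β (ζ m)) ^ (2 / α)) := by
    intro m
    rw [Measure.smul_apply, smul_eq_mul, ← ENNReal.ofReal_mul (by positivity), mul_assoc,
      ENNReal.ofReal_mul hlam.le]
    exact congrArg _ (volume_propLoss_lt hα (ζ m) t)
  simp only [h1]
  have hmζ : Measurable fun m => ENNReal.ofReal ((t * shadowFactor β (ζ m)) ^ (2 / α)) := hm.comp hζ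
  rw [lintegral_const_mul _ hmζ, ← lintegral_map hm hζ, hlaw,
    lintegral_mul_shadowFactor_rpow hξ ht', ← ENNReal.ofReal_mul (by positivity), mul_assoc]

/-- The mean number of line-of-sight stations with small propagation loss. -/
lemma prod_isLOS_and_propLoss_lt (hlam : 0 < lam) (hp : 0 ≤ p) (hD : 0 < D) (hα : 0 < α)
    (hξ : 0 < ξ) (hζ : Measurable ζ) (hlaw : ν.map ζ = gaussianReal 0 (ξ ^ 2).toNNReal)
    (hT : ν {m | m.1 = true} = ENNReal.ofReal p) (hind : IndepFun Prod.fst ζ ν) {t : ℝ≥0}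
    (ht : 0 < t) :
    ((ENNReal.ofReal lam • (volume : Measure Plane)).prod ν)
        {q | IsLOS D q.2.1 q.1 ∧ propLoss α β (ζ q.2) q.1 < t}
      = ENNReal.ofReal (lam * meanLOS p D β α ξ t) := by
  classical
  have ht' : (0 : ℝ) < t := ht
  let h : ℝ → ℝ≥0∞ := fun z => ENNReal.ofReal (min (D ^ 2) ((t * shadowFactor β z) ^ (2 / α)))
  have hm : Measurable h :=
    (measurable_const.min (((measurable_shadowFactor β).const_mul _).pow_const _)).ennreal_ofReal
  let b : Bool → ℝ≥0∞ := fun x => if x = true then 1 else 0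
  have hb : Measurable b := .of_discrete
  rw [Measure.prod_apply_symm (measurableSet_isLOS_and_propLoss_lt D α β hζ t)]
  have h1 : ∀ m : Bool × ℝ × ℝ, (ENNReal.ofReal lam • (volume : Measure Plane))
      ((fun x => (x, m)) ⁻¹' {q | IsLOS D q.2.1 q.1 ∧ propLoss α β (ζ q.2) q.1 < t})
      -- For a fixed mark the slice factorises into a blockage indicator and a function of the
      -- shadowing; their independence under `ν` then splits the average.
      = ENNReal.ofReal (lam * Real.pi) * (b m.1 * h (ζ m)) := by
    intro m
    rw [Measure.smul_apply, smul_eq_mul]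
    by_cases hm1 : m.1 = true
    · have h2 : (fun x : Plane => (x, m)) ⁻¹'
          {q | IsLOS D q.2.1 q.1 ∧ propLoss α β (ζ q.2) q.1 < t}
          = {y | ‖y‖ ≤ D ∧ propLoss α β (ζ m) y < t} := by
        ext y
        exact ⟨fun hy => ⟨hy.1.2, hy.2⟩, fun hy => ⟨⟨hm1, hy.1⟩, hy.2⟩⟩
      rw [h2, volume_norm_le_propLoss_lt hD hα, ENNReal.ofReal_mul Real.pi_pos.le,
        ENNReal.ofReal_mul hlam.le, mul_assoc]
      simp [b, h, hm1]
    · have h2 : (fun x : Plane => (x, m)) ⁻¹'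
          {q | IsLOS D q.2.1 q.1 ∧ propLoss α β (ζ q.2) q.1 < t} = ∅ := by
        ext y
        exact ⟨fun hy => (hm1 hy.1.1).elim, fun hy => hy.elim⟩
      rw [h2]
      simp [b, hm1]
  simp only [h1]
  have hbT : ∫⁻ m, b m.1 ∂ν = ENNReal.ofReal p := by
    rw [← hT, ← lintegral_indicator_one
      (measurableSet_eq_fun measurable_fst (measurable_const (a := true)))]
    exact lintegral_congr fun m => by simp [b, indicator_apply]
  have hbh : Measurable fun m : Bool × ℝ × ℝ => b m.1 * h (ζ m) :=
    (hb.comp measurable_fst).mul (hm.comp hζ)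
  rw [lintegral_const_mul _ hbh,
    lintegral_mul_eq_lintegral_mul_lintegral_of_indepFun'' (f := fun m : Bool × ℝ × ℝ => b m.1)
      (g := fun m => h (ζ m)) (hb.comp measurable_fst).aemeasurable (hm.comp hζ).aemeasurable
      (hind.comp hb hm), hbT, ← lintegral_map hm hζ, hlaw,
    lintegral_min_mul_shadowFactor_rpow hD hα hξ ht', ← ENNReal.ofReal_mul hp,
    ← ENNReal.ofReal_mul (by positivity), meanLOS]
  congr 1
  ring

lemma meanLOS_nonneg (hp : 0 ≤ p) {t : ℝ} (ht : 0 ≤ t) : 0 ≤ meanLOS p D β α ξ t := by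
  have h1 := gaussQ_nonneg (upsilon D β α ξ t)
  have h2 := gaussQ_nonneg (2 * logStd ξ ^ 2 / (α * logStd ξ) - upsilon D β α ξ t)
  have := Real.pi_pos
  unfold meanLOS
  positivity

/-- The mean number of non-line-of-sight stations with small propagation loss. -/
lemma prod_not_isLOS_and_propLoss_lt (hlam : 0 < lam) (hp : 0 ≤ p) (hD : 0 < D) (hα : 0 < α)
    (hξ : 0 < ξ) (hζ : Measurable ζ) (hlaw : ν.map ζ = gaussianReal 0 (ξ ^ 2).toNNReal)
    (hT : ν {m | m.1 = true} = ENNReal.ofReal p) (hind : IndepFun Prod.fst ζ ν) {t : ℝ≥0}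
    (ht : 0 < t) :
    ((ENNReal.ofReal lam • (volume : Measure Plane)).prod ν)
        {q | ¬ IsLOS D q.2.1 q.1 ∧ propLoss α β (ζ q.2) q.1 < t} < ∞ ∧
    (((ENNReal.ofReal lam • (volume : Measure Plane)).prod ν)
        {q | ¬ IsLOS D q.2.1 q.1 ∧ propLoss α β (ζ q.2) q.1 < t}).toReal
      = lam * meanNLOS p D β α ξ t := by
  have hL := prod_isLOS_and_propLoss_lt (β := β) hlam hp hD hα hξ hζ hlaw hT hind ht
  have hA := prod_propLoss_lt (β := β) hlam hα hξ hζ hlaw ht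
  set μ := (ENNReal.ofReal lam • (volume : Measure Plane)).prod ν
  have hset : {q : Plane × Bool × ℝ × ℝ | ¬ IsLOS D q.2.1 q.1 ∧ propLoss α β (ζ q.2) q.1 < t}
      = {q | propLoss α β (ζ q.2) q.1 < t}
        \ {q | IsLOS D q.2.1 q.1 ∧ propLoss α β (ζ q.2) q.1 < t} := by
    ext q
    exact ⟨fun h => ⟨h.2, fun h' => h.1 h'.1⟩, fun h => ⟨fun h' => h.2 ⟨h', h.1⟩, h.1⟩⟩
  have hsub : {q : Plane × Bool × ℝ × ℝ | IsLOS D q.2.1 q.1 ∧ propLoss α β (ζ q.2) q.1 < t}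
      ⊆ {q | propLoss α β (ζ q.2) q.1 < t} := fun q h => h.2
  have hLfin : μ {q | IsLOS D q.2.1 q.1 ∧ propLoss α β (ζ q.2) q.1 < t} ≠ ∞ := by
    rw [hL]; exact ENNReal.ofReal_ne_top
  have hAfin : μ {q | propLoss α β (ζ q.2) q.1 < t} ≠ ∞ := by
    rw [hA]; exact ENNReal.ofReal_ne_top
  refine ⟨(measure_mono fun q h => h.2).trans_lt hAfin.lt_top, ?_⟩
  -- Both measures are finite and nested, so the truncated subtraction becomes a real one, and
  -- nonnegativity of `meanNLOS` is never needed.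
  rw [hset, measure_sdiff hsub
    (measurableSet_isLOS_and_propLoss_lt D α β hζ t).nullMeasurableSet hLfin,
    ENNReal.toReal_sub_of_le (measure_mono hsub) hAfin, hA, hL,
    ENNReal.toReal_ofReal (mul_nonneg hlam.le (meanLOS_nonneg hp t.coe_nonneg)),
    ENNReal.toReal_ofReal (by have := Real.pi_pos; positivity), meanLOS, meanNLOS]
  ring

lemma prod_propLoss_eq (lam β : ℝ) (hα : 0 < α) (hζ : Measurable ζ) (t : ℝ≥0) :
    ((ENNReal.ofReal lam • (volume : Measure Plane)).prod ν)
      {q | propLoss α β (ζ q.2) q.1 = t} = 0 := by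
  have hs : MeasurableSet {q : Plane × Bool × ℝ × ℝ | propLoss α β (ζ q.2) q.1 = t} :=
    measurable_propLoss_mark α β hζ (measurableSet_singleton t)
  rw [Measure.prod_apply_symm hs]
  refine (lintegral_congr fun m => ?_).trans lintegral_zero
  rw [Measure.smul_apply]
  have : volume ((fun x : Plane => (x, m)) ⁻¹'
    {q : Plane × Bool × ℝ × ℝ | propLoss α β (ζ q.2) q.1 = t}) = 0 :=
    volume_propLoss_eq hα (ζ m) t
  rw [this, smul_zero]

/-- For each shadowing value a prescribed loss confines the station to a circle, which has area 0.
The absence of atoms makes the endpoints of intervals irrelevant. -/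
lemma nullSingletonClass_map_propLoss (lam β : ℝ) (hα : 0 < α) (hζ : Measurable ζ)
    (K : Set (Plane × Bool × ℝ × ℝ)) :
    NullSingletonClass ((((ENNReal.ofReal lam • (volume : Measure Plane)).prod ν).restrict K).map
      fun q => propLoss α β (ζ q.2) q.1) := by
  refine ⟨fun t => ?_⟩
  rw [Measure.map_apply (measurable_propLoss_mark α β hζ) (measurableSet_singleton t)]
  exact le_antisymm ((Measure.restrict_apply_le _ _).trans (prod_propLoss_eq lam β hα hζ t).le)
    zero_le

lemma NNReal.measure_lt_top_of_isCompact {μ : Measure ℝ≥0}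
    (h : ∀ t : ℝ≥0, 0 < t → μ (Ico 0 t) < ∞) {C : Set ℝ≥0} (hC : IsCompact C) : μ C < ∞ := by
  obtain ⟨b, hb⟩ := hC.bddAbove
  have hC : C ⊆ Ico 0 (b + 1) := fun x hx => ⟨zero_le, (hb hx).trans_lt (lt_add_one b)⟩
  exact (measure_mono hC).trans_lt (h (b + 1) (by positivity))

end Means

lemma map_restrict_propLoss_Ico {ν : Measure (Bool × ℝ × ℝ)} {ζ : Bool × ℝ × ℝ → ℝ}
    (lam α β : ℝ) (hζ : Measurable ζ)
    {K : Set (Plane × Bool × ℝ × ℝ)} (t : ℝ≥0) :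
    ((((ENNReal.ofReal lam • (volume : Measure Plane)).prod ν).restrict K).map
      fun q => propLoss α β (ζ q.2) q.1) (Ico 0 t)
      = ((ENNReal.ofReal lam • (volume : Measure Plane)).prod ν)
        {q | q ∈ K ∧ propLoss α β (ζ q.2) q.1 < t} := by
  rw [Measure.map_apply (measurable_propLoss_mark α β hζ) measurableSet_Ico,
    Measure.restrict_apply (measurable_propLoss_mark α β hζ measurableSet_Ico)]
  congr 1
  ext q
  exact ⟨fun h => ⟨h.2, h.1.2⟩, fun h => ⟨⟨zero_le, h.2⟩, h.1⟩⟩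

/-! ### Intensities of the LOS and NLOS stations. -/

section Stations

variable {p D : ℝ} {ν : Measure (Bool × ℝ × ℝ)} [IsProbabilityMeasure ν]

lemma map_fst_restrict_isLOS {lam : ℝ} (hlam : 0 < lam)
    (hT : ν {m | m.1 = true} = ENNReal.ofReal p) :
    (((ENNReal.ofReal lam • (volume : Measure Plane)).prod ν).restrict
      {q | IsLOS D q.2.1 q.1}).map Prod.fst
      = ENNReal.ofReal (lam * p) • volume.restrict {x : Plane | ‖x‖ ≤ D} := by
  ext B hB
  rw [Measure.map_apply measurable_fst hB, Measure.restrict_apply (measurable_fst hB)]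
  have h : Prod.fst ⁻¹' B ∩ {q : Plane × Bool × ℝ × ℝ | IsLOS D q.2.1 q.1}
      = (B ∩ {x : Plane | ‖x‖ ≤ D}) ×ˢ {m : Bool × ℝ × ℝ | m.1 = true} := by
    ext q
    exact ⟨fun h => ⟨⟨h.1, h.2.2⟩, h.2.1⟩, fun h => ⟨h.1.1, h.2, h.1.2⟩⟩
  rw [h, Measure.prod_prod, hT, Measure.smul_apply, Measure.smul_apply, Measure.restrict_apply hB,
    smul_eq_mul, smul_eq_mul, ENNReal.ofReal_mul hlam.le]
  ring

lemma map_fst_restrict_not_isLOS {lam : ℝ} (hlam : 0 < lam) (hp : 0 ≤ p)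
    (hT : ν {m | m.1 = true} = ENNReal.ofReal p) :
    (((ENNReal.ofReal lam • (volume : Measure Plane)).prod ν).restrict
      {q | ¬ IsLOS D q.2.1 q.1}).map Prod.fst
      = ENNReal.ofReal (lam * (1 - p)) • volume.restrict {x : Plane | ‖x‖ ≤ D}
        + ENNReal.ofReal lam • volume.restrict {x : Plane | D < ‖x‖} := by
  have hTm : MeasurableSet {m : Bool × ℝ × ℝ | m.1 = true} :=
    measurableSet_eq_fun measurable_fst measurable_const
  have hT' : ν {m | m.1 = true}ᶜ = ENNReal.ofReal (1 - p) := by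
    rw [prob_compl_eq_one_sub hTm, hT, ENNReal.ofReal_sub _ hp, ENNReal.ofReal_one]
  have hDm : MeasurableSet {x : Plane | D < ‖x‖} := measurableSet_lt measurable_const measurable_norm
  ext B hB
  rw [Measure.map_apply measurable_fst hB, Measure.restrict_apply (measurable_fst hB)]
  have h : Prod.fst ⁻¹' B ∩ {q : Plane × Bool × ℝ × ℝ | ¬ IsLOS D q.2.1 q.1}
      = ((B ∩ {x : Plane | ‖x‖ ≤ D}) ×ˢ {m : Bool × ℝ × ℝ | m.1 = true}ᶜ)
        ∪ ((B ∩ {x : Plane | D < ‖x‖}) ×ˢ univ) := by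
    ext q
    constructor
    · intro h
      rcases le_or_gt ‖q.1‖ D with hq | hq
      · exact .inl ⟨⟨h.1, hq⟩, fun h' => h.2 ⟨h', hq⟩⟩
      · exact .inr ⟨⟨h.1, hq⟩, trivial⟩
    · rintro (h | h)
      · exact ⟨h.1.1, fun h' => h.2 h'.1⟩
      · exact ⟨h.1.1, fun h' => not_lt.2 h'.2 h.1.2⟩
  rw [h, measure_union _ ((hB.inter hDm).prod .univ), Measure.prod_prod, Measure.prod_prod, hT',
    measure_univ, Measure.add_apply]
  · simp only [Measure.smul_apply, Measure.restrict_apply hB, smul_eq_mul,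
      ENNReal.ofReal_mul hlam.le]
    ring
  · rw [disjoint_left]
    intro q h h'
    have h1 : ‖q.1‖ ≤ D := h.1.2
    have h2 : D < ‖q.1‖ := h'.1.2
    exact h1.not_gt h2

end Stations

lemma indepFun_map_of_comp {Ω Ω' α β : Type*} [MeasurableSpace Ω] [MeasurableSpace Ω']
    [MeasurableSpace α] [MeasurableSpace β] {P : Measure Ω} [IsFiniteMeasure P] {m : Ω → Ω'}
    (hm : Measurable m) {f : Ω' → α} {g : Ω' → β} (hf : Measurable f) (hg : Measurable g)
    (h : IndepFun (fun ω => f (m ω)) (fun ω => g (m ω)) P) : IndepFun f g (P.map m) := by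
  rw [indepFun_iff_map_prod_eq_prod_map_map hf.aemeasurable hg.aemeasurable,
    Measure.map_map (hf.prodMk hg) hm, Measure.map_map hf hm, Measure.map_map hg hm]
  exact (indepFun_iff_map_prod_eq_prod_map_map (hf.comp hm).aemeasurable
    (hg.comp hm).aemeasurable).1 h

/-! ### Superposition of the two loss processes. -/

section Superposition

/-- This identifies the mean measure of the superposition when all losses are viewed as one
piecewise image of the marked stations; independence of the LOS and NLOS processes is not required.
-/
lemma map_ite_eq_add_map_restrict {α β : Type*} [MeasurableSpace α] [MeasurableSpace β] (μ : Measure α)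
    {K : Set α} [DecidablePred (· ∈ K)] (hK : MeasurableSet K) {f g : α → β} (hf : Measurable f)
    (hg : Measurable g) :
    μ.map (fun a => if a ∈ K then f a else g a) = (μ.restrict K).map f + (μ.restrict Kᶜ).map g := by
  ext B hB
  have hm : Measurable fun a => if a ∈ K then f a else g a := Measurable.ite hK hf hg
  rw [Measure.map_apply hm hB, Measure.add_apply, Measure.map_apply hf hB,
    Measure.map_apply hg hB, Measure.restrict_apply (hf hB), Measure.restrict_apply (hg hB),
    ← measure_inter_add_sdiff _ hK]
  congr 2
  · ext a
    by_cases h : a ∈ K <;> simp [h]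
  · ext a
    by_cases h : a ∈ K <;> simp [h]

lemma allLosses_eq_add {Ω : Type*} (D β αL αN : ℝ) (X : ℕ → Ω → Plane) (T : ℕ → Ω → Bool)
    (ZL ZN : ℕ → Ω → ℝ) (ω : Ω) :
    allLosses D β αL αN X T ZL ZN ω
      = losLosses D β αL X T ZL ω + nlosLosses D β αN X T ZN ω := by
  classical
  rw [allLosses, losLosses, nlosLosses, pointMeasure, pointMeasure, pointMeasure,
    Measure.sum_add_sum]
  congr 1
  ext1 n
  by_cases h : IsLOS D (T n ω) (X n ω) <;> simp [h]

end Superposition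

/-! ### The main theorem. -/

theorem lemma3 {Ω : Type*} [MeasurableSpace Ω] (P : Measure Ω) [IsProbabilityMeasure P]
    (lam p D β αL αN ξL ξN : ℝ) (hlam : 0 < lam) (hp : p ∈ Icc (0 : ℝ) 1) (hD : 0 < D)
    (hαL : 0 < αL) (hαN : 0 < αN) (hξL : 0 < ξL) (hξN : 0 < ξN)
    (X : ℕ → Ω → Plane) (T : ℕ → Ω → Bool) (ZL ZN : ℕ → Ω → ℝ)
    (hnet : IsCellularNetwork P lam p ξL ξN X T ZL ZN) :
    -- the line-of-sight and non-line-of-sight stations are Poisson with the intensities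
    -- `lam p 1_{‖x‖ ≤ D}` and `lam (1 - p) 1_{‖x‖ ≤ D} + lam 1_{‖x‖ > D}`
    IsPoissonPointProcess P (losStations D X T)
      (ENNReal.ofReal (lam * p) • volume.restrict {x : Plane | ‖x‖ ≤ D}) ∧
    IsPoissonPointProcess P (nlosStations D X T)
      (ENNReal.ofReal (lam * (1 - p)) • volume.restrict {x : Plane | ‖x‖ ≤ D}
        + ENNReal.ofReal lam • volume.restrict {x : Plane | D < ‖x‖}) ∧
    -- the line-of-sight propagation losses
    (∃ ΛL : Measure ℝ≥0, IsPoissonPointProcess P (losLosses D β αL X T ZL) ΛL ∧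
      ∀ t : ℝ≥0, 0 < t → ΛL (Ico 0 t) < ∞ ∧
        (ΛL (Ico 0 t)).toReal = lam * meanLOS p D β αL ξL t) ∧
    -- the non-line-of-sight propagation losses
    (∃ ΛN : Measure ℝ≥0, IsPoissonPointProcess P (nlosLosses D β αN X T ZN) ΛN ∧
      ∀ t : ℝ≥0, 0 < t → ΛN (Ico 0 t) < ∞ ∧
        (ΛN (Ico 0 t)).toReal = lam * meanNLOS p D β αN ξN t) ∧
    -- the propagation losses of all stations: the superposition of the two
    (∀ ω, allLosses D β αL αN X T ZL ZN ω
      = losLosses D β αL X T ZL ω + nlosLosses D β αN X T ZN ω) ∧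
    (∃ Λ : Measure ℝ≥0, IsPoissonPointProcess P (allLosses D β αL αN X T ZL ZN) Λ ∧
      ∀ t : ℝ≥0, 0 < t → Λ (Icc 0 t) < ∞ ∧
        (Λ (Ico 0 t)).toReal = lam * (meanLOS p D β αL ξL t + meanNLOS p D β αN ξN t) ∧
        (Λ (Ioc 0 t)).toReal = lam * (meanLOS p D β αL ξL t + meanNLOS p D β αN ξN t)) := by
  classical
  let m : ℕ → Ω → Bool × ℝ × ℝ := fun n ω => (T n ω, ZL n ω, ZN n ω)
  have hm : ∀ n, Measurable (m n) := fun n =>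
    (hnet.measurable_T n).prodMk ((hnet.measurable_ZL n).prodMk (hnet.measurable_ZN n))
  let ν := P.map (m 0)
  have hν : IsProbabilityMeasure ν := Measure.isProbabilityMeasure_map (hm 0).aemeasurable
  have hlaw : ∀ n, P.map (m n) = ν := fun n => (hnet.marks_identDistrib n).map_eq
  let μ := (ENNReal.ofReal lam • (volume : Measure Plane)).prod ν
  let K : Set (Plane × Bool × ℝ × ℝ) := {q | IsLOS D q.2.1 q.1}
  have hK : MeasurableSet K := measurableSet_isLOS D
  let ζL : Bool × ℝ × ℝ → ℝ := fun q => q.2.1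
  let ζN : Bool × ℝ × ℝ → ℝ := fun q => q.2.2
  have hζL : Measurable ζL := measurable_snd.fst
  have hζN : Measurable ζN := measurable_snd.snd
  have hlawL : ν.map ζL = gaussianReal 0 (ξL ^ 2).toNNReal := by
    rw [Measure.map_map hζL (hm 0)]; exact (hnet.gaussianL 0).map_eq
  have hlawN : ν.map ζN = gaussianReal 0 (ξN ^ 2).toNNReal := by
    rw [Measure.map_map hζN (hm 0)]; exact (hnet.gaussianN 0).map_eq
  have hindL : IndepFun Prod.fst ζL ν :=
    indepFun_map_of_comp (hm 0) measurable_fst hζL (hnet.indepL 0)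
  have hindN : IndepFun Prod.fst ζN ν :=
    indepFun_map_of_comp (hm 0) measurable_fst hζN (hnet.indepN 0)
  have hT : ν {q | q.1 = true} = ENNReal.ofReal p := by
    rw [Measure.map_apply (hm 0) (measurableSet_eq_fun measurable_fst measurable_const),
      ← hnet.bernoulli 0, ofReal_measureReal]
    rfl
  -- A common form for all five processes: each is given by a retained set `A` of marked stations
  -- and a map `φ`.
  have key : ∀ {F : Type} [TopologicalSpace F] [MeasurableSpace F] [T2Space F]
      [OpensMeasurableSpace F] [SigmaCompactSpace F] [WeaklyLocallyCompactSpace F]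
      (A : Set (Plane × Bool × ℝ × ℝ)) (_ : MeasurableSet A) (φ : Plane × Bool × ℝ × ℝ → F)
      (_ : Measurable φ) (N : Ω → Measure F) (Λ' : Measure F)
      (_ : N = fun ω => pointMeasure (fun n => (X n ω, m n ω) ∈ A) fun n => φ (X n ω, m n ω))
      (_ : (μ.restrict A).map φ = Λ') (_ : ∀ C : Set F, IsCompact C → Λ' C < ∞),
      IsPoissonPointProcess P N Λ' := by
    intro F _ _ _ _ _ _ A hA φ hφ N Λ' hN hΛ' hfin
    subst hN hΛ'
    exact isPoissonPointProcess_marked hnet.poisson hnet.measurable_X hm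
      hnet.marks_indep_positions hnet.marks_indep hlaw hA hφ hfin
  let φL : Plane × Bool × ℝ × ℝ → ℝ≥0 := fun q => propLoss αL β (ζL q.2) q.1
  let φN : Plane × Bool × ℝ × ℝ → ℝ≥0 := fun q => propLoss αN β (ζN q.2) q.1
  have hφL : Measurable φL := measurable_propLoss_mark αL β hζL
  have hφN : Measurable φN := measurable_propLoss_mark αN β hζN
  let ΛL := (μ.restrict K).map φL
  let ΛN := (μ.restrict Kᶜ).map φN
  have hΛL : ∀ t : ℝ≥0, 0 < t → ΛL (Ico 0 t) < ∞ ∧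
      (ΛL (Ico 0 t)).toReal = lam * meanLOS p D β αL ξL t := by
    intro t ht
    have h : ΛL (Ico 0 t) = ENNReal.ofReal (lam * meanLOS p D β αL ξL t) :=
      (map_restrict_propLoss_Ico lam αL β hζL t).trans
        (prod_isLOS_and_propLoss_lt hlam hp.1 hD hαL hξL hζL hlawL hT hindL ht)
    rw [h]
    exact ⟨ENNReal.ofReal_lt_top,
      ENNReal.toReal_ofReal (mul_nonneg hlam.le (meanLOS_nonneg hp.1 t.coe_nonneg))⟩
  have hΛN : ∀ t : ℝ≥0, 0 < t → ΛN (Ico 0 t) < ∞ ∧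
      (ΛN (Ico 0 t)).toReal = lam * meanNLOS p D β αN ξN t := by
    intro t ht
    have h : ΛN (Ico 0 t) = _ := map_restrict_propLoss_Ico lam αN β hζN t
    rw [h]
    exact prod_not_isLOS_and_propLoss_lt hlam hp.1 hD hαN hξN hζN hlawN hT hindN ht
  have hΛLc : ∀ C : Set ℝ≥0, IsCompact C → ΛL C < ∞ := fun C hC =>
    NNReal.measure_lt_top_of_isCompact (fun t ht => (hΛL t ht).1) hC
  have hΛNc : ∀ C : Set ℝ≥0, IsCompact C → ΛN C < ∞ := fun C hC =>
    NNReal.measure_lt_top_of_isCompact (fun t ht => (hΛN t ht).1) hC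
  have hnullL : NullSingletonClass ΛL := nullSingletonClass_map_propLoss lam β hαL hζL K
  have hnullN : NullSingletonClass ΛN := nullSingletonClass_map_propLoss lam β hαN hζN Kᶜ
  have hvol : ∀ (c : ℝ) (A C : Set Plane), IsCompact C →
      (ENNReal.ofReal c • volume.restrict A) C < ∞ := by
    intro c A C hC
    rw [Measure.smul_apply, smul_eq_mul]
    exact ENNReal.mul_lt_top ENNReal.ofReal_lt_top
      ((Measure.restrict_apply_le _ _).trans_lt hC.measure_lt_top)
  refine ⟨?_, ?_, ⟨ΛL, ?_, hΛL⟩, ⟨ΛN, ?_, hΛN⟩, allLosses_eq_add D β αL αN X T ZL ZN,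
    ⟨ΛL + ΛN, ?_, ?_⟩⟩
  · exact key K hK Prod.fst measurable_fst _ _ rfl (map_fst_restrict_isLOS hlam hT) (hvol _ _)
  · refine key Kᶜ hK.compl Prod.fst measurable_fst _ _ rfl
      (map_fst_restrict_not_isLOS hlam hp.1 hT) (fun C hC => ?_)
    rw [Measure.add_apply]
    exact ENNReal.add_lt_top.2 ⟨hvol _ _ C hC, hvol _ _ C hC⟩
  · exact key K hK φL hφL _ _ rfl rfl hΛLc
  · exact key Kᶜ hK.compl φN hφN _ _ rfl rfl hΛNc
  -- Every station is kept, and the map is `φL` on `K` and `φN` off it.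
  · refine key univ .univ _ (Measurable.ite hK hφL hφN) _ _ ?_
      (by rw [Measure.restrict_univ]; exact map_ite_eq_add_map_restrict μ hK hφL hφN) (fun C hC => ?_)
    · ext1 ω
      simp only [allLosses, mem_univ]
      rfl
    · rw [Measure.add_apply]
      exact ENNReal.add_lt_top.2 ⟨hΛLc C hC, hΛNc C hC⟩
  · intro t ht
    have hIco : ((ΛL + ΛN) (Ico 0 t)).toReal
        = lam * (meanLOS p D β αL ξL t + meanNLOS p D β αN ξN t) := by
      rw [Measure.add_apply, ENNReal.toReal_add (hΛL t ht).1.ne (hΛN t ht).1.ne, (hΛL t ht).2,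
        (hΛN t ht).2, mul_add]
    refine ⟨?_, hIco, ?_⟩
    · rw [Measure.add_apply]
      exact ENNReal.add_lt_top.2 ⟨hΛLc _ isCompact_Icc, hΛNc _ isCompact_Icc⟩
    · rw [← hIco, Measure.add_apply, Measure.add_apply,
        measure_congr (Ico_ae_eq_Ioc (μ := ΛL) (a := 0) (b := t)),
        measure_congr (Ico_ae_eq_Ioc (μ := ΛN) (a := 0) (b := t))]
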